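/- Let $D>0$ and consider the switched system with delayed scalar input $$\dot X(t)=A_{\sigma(t)}X(t)+B_{\sigma(t)}U(t-D),\qquad X(0)=X_0\in\mathbb R^q,\quad U=U_0\in L^2([-D,0];\mathbb R)\text{ on }[-D,0],$$ with modes $A_i\in\mathbb R^{q\times q}$, $B_i\in\mathbb R^{q\times 1}$, and gains $K_i\in\mathbb R^{1\times q}$, $i=1,\dots,p$, such that every $A_i+B_iK_i$ is Hurwitz. The switching signal $\sigma:[0,\infty)\to\{1,\dots,p\}$ has switching times $0=t_0<t_1<t_2<\cdots$, is constant on each $[t_k,t_{k+1})$, and satisfies $\tau_d\le t_{k+1}-t_k\le\bar\tau_d$ for all $k\ge 0$. Put $\tau_0(t)=\max\{t_k : t_k\le t\}$, $\tau(t)=\max\{0,\min\{\tau_0(t)+\tau_d-t,\,D\}\}$ (which is $\max\{0,\tau_0(t)+\tau_d-t\}$ when $\tau_d\le D$) and, with $m=\sigma(\tau_0(t))$, $$X(t+\tau(t))=e^{A_m\tau(t)}X(t)+\int_{t-D}^{t+\tau(t)-D}e^{A_m(t+\tau(t)-D-\theta)}B_mU(\theta)\,d\theta,$$ $$\hat P_i(t)=e^{A_i(D-\tau(t))}X(t+\tau(t))+\int_{t+\tau(t)-D}^{t}e^{A_i(t-\theta)}B_iU(\theta)\,d\theta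 .$$ Close the loop with $U(t)=\frac1p\sum_{i=1}^pK_i\hat P_i(t)$, $t\ge 0$, and let $|\cdot|$ be the Euclidean norm and the matrix norm that it induces. Then there exist $\bar\tau_d^\star>0$ and $\bar\epsilon^\star>0$ such that, whenever $\tau_d>\bar\tau_d^\star$ and $$\bar\epsilon=\max_{i,j=1,\dots,p}\{|A_i-A_j|,|B_i-B_j|,|K_i-K_j|\}<\bar\epsilon^\star,$$ the closed-loop system is uniformly exponentially stable: there are $\rho,\bar\xi>0$ such that for all switching signals as above, all $X_0$ and $U_0$, and all solutions, $$|X(t)|+\sqrt{\int_{t-D}^{t}U(\theta)^2d\theta}\;\le\;\rho\Bigl(|X(0)|+\sqrt{\int_{-D}^{0}U(\theta)^2d\theta}\Bigr)e^{-\bar\xi t},\qquad t\ge 0 .$$ Here $\bar\tau_d^\star$ and $\bar\epsilon^\star$ depend on the modes and gains only through bounds, not through the differences between the modes: for each $q$, $D$ and each compact set $\mathcal K$ of triples $(A,B,K)$ with $A+BK$ Hurwitz, one pair $(\bar\tau_d^\star,\bar\epsilon^\star)$ serves all finite families of modes $(A_i,B_i,K_i)\in\mathcal K$. The constants $\rho$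 and $\bar\xi$ may depend on the modes and gains, on $\tau_d$ and on $\bar\tau_d$, but not on $\sigma$, $X_0$ or $U_0$. -/

import Mathlib

open MeasureTheory Set

/-- The state space `ℝ^q` with the Euclidean norm. -/
abbrev StateSpace (q : ℕ) : Type := EuclideanSpace ℝ (Fin q)

/-- Square matrices `A`, regarded as linear maps of `ℝ^q`;
the norm is the one induced by the Euclidean norm. -/
abbrev SysMat (q : ℕ) : Type := StateSpace q →L[ℝ] StateSpace q

/-- Gains `K` (row vectors), regarded as linear functionals on `ℝ^q`. -/
abbrev Gain (q : ℕ) : Type := StateSpace q →L[ℝ] ℝ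

/-- The delay-free closed-loop matrix `A + B K`. -/
noncomputable def closedLoopMat {q : ℕ} (A : SysMat q) (B : StateSpace q) (K : Gain q) :
    SysMat q :=
  A + K.smulRight B

/-- `H` is Hurwitz: every complex root of its characteristic polynomial has negative real part. -/
def IsHurwitz {q : ℕ} (H : SysMat q) : Prop :=
  ∀ z : ℂ, ((LinearMap.charpoly (H : StateSpace q →ₗ[ℝ] StateSpace q)).map
    (algebraMap ℝ ℂ)).IsRoot z → z.re < 0

/-- `max_{i,j} {|A_i - A_j|, |B_i - B_j|, |K_i - K_j|}`. -/
noncomputable def modeSpread {p q : ℕ} (A : Fin p → SysMat q) (B : Fin p → StateSpace q)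
    (K : Fin p → Gain q) : ℝ :=
  ⨆ ij : Fin p × Fin p,
    max ‖A ij.1 - A ij.2‖ (max ‖B ij.1 - B ij.2‖ ‖K ij.1 - K ij.2‖)

/-- `σ` is a switching signal with switching times `0 = t_0 < t_1 < ...`, constant on every
`[t_k, t_{k+1})`, with minimum dwell time `τd` and maximum dwell time `τmax`. -/
structure IsDwellSwitching {p : ℕ} (σ : ℝ → Fin p) (tk : ℕ → ℝ) (τd τmax : ℝ) : Prop where
  zero : tk 0 = 0
  strictMono : StrictMono tk
  min_dwell : ∀ k, τd ≤ tk (k + 1) - tk k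
  max_dwell : ∀ k, tk (k + 1) - tk k ≤ τmax
  const : ∀ k, ∀ t ∈ Ico (tk k) (tk (k + 1)), σ t = σ (tk k)

/-- The last switching time up to `t`: `τ₀(t) = max {t_k | t_k ≤ t}`. -/
noncomputable def lastSwitch (tk : ℕ → ℝ) (t : ℝ) : ℝ :=
  sSup (range tk ∩ Iic t)

/-- The exact prediction horizon `τ(t) = max {0, min {τ₀(t) + τd - t, D}}`.
For `τd ≤ D` and `t ≥ 0` the inner minimum with `D` has no effect. -/
noncomputable def horizon (D τd : ℝ) (tk : ℕ → ℝ) (t : ℝ) : ℝ :=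
  max 0 (min (lastSwitch tk t + τd - t) D)

/-- The exact prediction of the state at time `t + τ(t)`, computed at time `t`:
`e^{A τ(t)} X(t) + ∫_{t-D}^{t+τ(t)-D} e^{A (t+τ(t)-D-θ)} B U(θ) dθ`
with `A = A_{σ(τ₀(t))}` and `B = B_{σ(τ₀(t))}`. -/
noncomputable def exactPrediction {p q : ℕ} (A : Fin p → SysMat q) (B : Fin p → StateSpace q)
    (D τd : ℝ) (σ : ℝ → Fin p) (tk : ℕ → ℝ) (X : ℝ → StateSpace q) (U : ℝ → ℝ) (t : ℝ) :
    StateSpace q :=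
  NormedSpace.exp (horizon D τd tk t • A (σ (lastSwitch tk t))) (X t) +
    ∫ θ in (t - D)..(t + horizon D τd tk t - D),
      NormedSpace.exp ((t + horizon D τd tk t - D - θ) • A (σ (lastSwitch tk t)))
        (U θ • B (σ (lastSwitch tk t)))

/-- The predictor of mode `i`:
`P̂_i(t) = e^{A_i (D-τ(t))} X(t+τ(t)) + ∫_{t+τ(t)-D}^{t} e^{A_i (t-θ)} B_i U(θ) dθ`. -/
noncomputable def modePredictor {p q : ℕ} (A : Fin p → SysMat q) (B : Fin p → StateSpace q)
    (D τd : ℝ) (σ : ℝ → Fin p) (tk : ℕ → ℝ) (X : ℝ → StateSpace q) (U : ℝ → ℝ) (i : Fin p)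
    (t : ℝ) : StateSpace q :=
  NormedSpace.exp ((D - horizon D τd tk t) • A i) (exactPrediction A B D τd σ tk X U t) +
    ∫ θ in (t + horizon D τd tk t - D)..t, NormedSpace.exp ((t - θ) • A i) (U θ • B i)

/-- The controller `U_2(t) = (1/p) ∑ i, K_i P̂_i(t)`. -/
noncomputable def averagedFeedback {p q : ℕ} (A : Fin p → SysMat q) (B : Fin p → StateSpace q)
    (K : Fin p → Gain q) (D τd : ℝ) (σ : ℝ → Fin p) (tk : ℕ → ℝ) (X : ℝ → StateSpace q)
    (U : ℝ → ℝ) (t : ℝ) : ℝ :=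
  (1 / (p : ℝ)) * ∑ i, K i (modePredictor A B D τd σ tk X U i t)

/-- `(X, U)` is a (Carathéodory) solution on `[0, ∞)` of the closed loop
`X'(t) = A_{σ(t)} X(t) + B_{σ(t)} U(t - D)`, `U(t) = U_2(t)`, with initial state `X₀` and
initial input `U₀` on `[-D, 0]`. The differential equation is written in integrated form, and
the input is square integrable on bounded intervals. -/
structure IsClosedLoopSolution {p q : ℕ} (A : Fin p → SysMat q) (B : Fin p → StateSpace q)
    (K : Fin p → Gain q) (D τd : ℝ) (σ : ℝ → Fin p) (tk : ℕ → ℝ)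
    (X₀ : StateSpace q) (U₀ : ℝ → ℝ) (X : ℝ → StateSpace q) (U : ℝ → ℝ) : Prop where
  continuousOn : ContinuousOn X (Ici 0)
  memLp : ∀ T, 0 ≤ T → MemLp U 2 (volume.restrict (Icc (-D) T))
  initial : U =ᵐ[volume.restrict (Icc (-D) 0)] U₀
  plant : ∀ t, 0 ≤ t →
    X t = X₀ + ∫ s in (0 : ℝ)..t, (A (σ s) (X s) + U (s - D) • B (σ s))
  control : ∀ t, 0 ≤ t → U t = averagedFeedback A B K D τd σ tk X U t

/-! When all modes are close to one nominal mode (A₀, B₀, K₀), switching between them is, at any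
switching times, a small time-varying perturbation of the unswitched predictor loop. No Lyapunov
function per mode and no large dwell time is needed; a positive dwell time only keeps the switching
times from accumulating.

Size is measured by `delaySize`, the norm of X(t) plus the L¹ norm of the input on [t-D, t]. By
`IsClosedLoopSolution.isPerturbedLoop`, the plant and the averaged feedback differ from their
nominal versions by small multiples of the quantities this size controls. In the exact nominal loop
the predictor equals X(t+D), so U(t) = K₀ X(t+D), and after one delay the state obeys X' = (A₀ +
B₀K₀)X. In the perturbed loop this holds up to O(δ) (`norm_state_sub_predictor_le`, `norm_state_le`,
both by `duhamel`).

Since exp(t(A₀ + B₀K₀)) tends to 0 (`IsHurwitz.tendsto_exp_smul`), a fixed time T and then a small δ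
can be chosen so that the size halves over every period T. Gronwall's inequality bounds its growth
within a period, and exponential decay follows (`exists_perturbedLoop_decay`). The bound of |U(t)|
by the size converts L¹ decay into L² decay.

This gives a neighbourhood of each Hurwitz triple in which every family of modes is stable
(`eventually_uniform_stability`). A Lebesgue number of the cover of the compact set by these
neighbourhoods is the common threshold for the spread of the modes. -/

/-! ### Gronwall's inequality in integral form -/

theorem gronwall_integral {z : ℝ → ℝ} {a b C₀ C₁ : ℝ} (hC₁ : 0 ≤ C₁)
    (hz : ContinuousOn z (Icc a b))
    (h : ∀ t ∈ Icc a b, z t ≤ C₀ + C₁ * ∫ s in a..t, z s) :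
    ∀ t ∈ Icc a b, z t ≤ C₀ * Real.exp (C₁ * (t - a)) := by
  intro t ht
  have hab : a ≤ b := ht.1.trans ht.2
  set Z : ℝ → ℝ := fun t => C₀ + C₁ * ∫ s in a..t, z s with hZ
  have hint : IntervalIntegrable z volume a b := by
    apply ContinuousOn.intervalIntegrable; rwa [uIcc_of_le hab]
  -- Integrating factor: Z' = C₁z ≤ C₁Z, so exp(-C₁(t-a)) Z(t) cannot increase, and Z(a) = C₀.
  have hanti : AntitoneOn (fun t => Real.exp (-(C₁ * (t - a))) * Z t) (Icc a b) := by
    have hder : ∀ x ∈ Ioo a b, HasDerivAt (fun t => Real.exp (-(C₁ * (t - a))) * Z t)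
        (Real.exp (-(C₁ * (x - a))) * (-(C₁ * 1)) * Z x +
          Real.exp (-(C₁ * (x - a))) * (C₁ * z x)) x := by
      intro x hx
      have h1 : HasDerivAt (fun t => ∫ s in a..t, z s) (z x) x := by
        apply intervalIntegral.integral_hasDerivAt_right
        · exact hint.mono_set (by
            rw [uIcc_of_le hab, uIcc_of_le hx.1.le]; exact Icc_subset_Icc_right hx.2.le)
        · exact (hz.mono Ioo_subset_Icc_self).stronglyMeasurableAtFilter isOpen_Ioo x hx
        · exact hz.continuousAt (Icc_mem_nhds hx.1 hx.2)
      have h2 : HasDerivAt Z (C₁ * z x) x := (h1.const_mul C₁).const_add C₀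
      exact ((((hasDerivAt_id x).sub_const a).const_mul C₁).neg.exp).mul h2
    apply antitoneOn_of_deriv_nonpos (convex_Icc a b)
    · apply ContinuousOn.mul (by fun_prop)
      have := intervalIntegral.continuousOn_primitive_interval
        (hint.1.congr_set_ae (Ioc_ae_eq_Icc (μ := volume)).symm |> fun h => by
          rwa [← uIcc_of_le hab] at h)
      rw [uIcc_of_le hab] at this
      exact continuousOn_const.add (continuousOn_const.mul this)
    · rw [interior_Icc]
      exact fun x hx => (hder x hx).differentiableAt.differentiableWithinAt
    · rw [interior_Icc]
      intro x hx
      rw [(hder x hx).deriv]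
      have h3 := h x (Ioo_subset_Icc_self hx)
      have : 0 ≤ Real.exp (-(C₁ * (x - a))) * C₁ * (Z x - z x) :=
        mul_nonneg (mul_nonneg (Real.exp_pos _).le hC₁) (sub_nonneg.2 h3)
      linarith
  have h4 := hanti (left_mem_Icc.2 hab) ht ht.1
  simp only [hZ, sub_self, mul_zero, neg_zero, Real.exp_zero, one_mul,
    intervalIntegral.integral_same, add_zero] at h4
  have h5 : Z t ≤ C₀ * Real.exp (C₁ * (t - a)) := by
    have := mul_le_mul_of_nonneg_left h4 (Real.exp_pos (C₁ * (t - a))).le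
    rw [← mul_assoc, ← Real.exp_add, add_neg_cancel, Real.exp_zero, one_mul] at this
    linarith [mul_comm C₀ (Real.exp (C₁ * (t - a)))]
  exact (h t ht).trans h5

/-! ### Variation of constants with merely integrable forcing -/

section Duhamel

variable {E : Type*} [NormedAddCommGroup E] [NormedSpace ℝ E]

theorem intervalIntegrable_clm_apply {F : ℝ → E →L[ℝ] E} {h : ℝ → E} {a b : ℝ}
    (hF : Continuous F) (hh : IntervalIntegrable h volume a b) :
    IntervalIntegrable (fun r => F r (h r)) volume a b := by
  rw [intervalIntegrable_iff] at hh ⊢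
  obtain ⟨C, hC⟩ := isCompact_uIcc.exists_bound_of_continuousOn (hF.continuousOn (s := uIcc a b))
  refine Integrable.mono' (hh.norm.const_mul C)
    ((ContinuousLinearMap.id ℝ (E →L[ℝ] E)).aestronglyMeasurable_comp₂
      hF.aestronglyMeasurable hh.aestronglyMeasurable) ?_
  filter_upwards [ae_restrict_mem measurableSet_uIoc] with r hr
  exact ((F r).le_opNorm _).trans
    (mul_le_mul_of_nonneg_right (hC r (uIoc_subset_uIcc hr)) (norm_nonneg _))

theorem intervalIntegrable_smul_const {g : ℝ → ℝ} {a b : ℝ} (hg : IntervalIntegrable g volume a b)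
    (v : E) : IntervalIntegrable (fun r => g r • v) volume a b :=
  ⟨hg.1.smul_const v, hg.2.smul_const v⟩

theorem intervalIntegrable_clm_comp {F : Type*} [NormedAddCommGroup F] [NormedSpace ℝ F]
    (L : E →L[ℝ] F) {g : ℝ → E} {a b : ℝ} (hg : IntervalIntegrable g volume a b) :
    IntervalIntegrable (fun r => L (g r)) volume a b :=
  ⟨L.integrable_comp hg.1, L.integrable_comp hg.2⟩

variable [CompleteSpace E]

/-- Integration by parts of a `C¹` operator family against a primitive of an integrable
function. -/
theorem integral_clm_apply_eq_sub {F F' : ℝ → E →L[ℝ] E} {h : ℝ → E} {a b : ℝ} (hab : a ≤ b)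
    (hF : ∀ r, HasDerivAt F (F' r) r) (hF' : Continuous F')
    (hh : IntervalIntegrable h volume a b) :
    ∫ r in a..b, F r (h r) =
      F b (∫ r in a..b, h r) - ∫ u in a..b, F' u (∫ r in a..u, h r) := by
  have hFc : Continuous F := continuous_iff_continuousAt.2 fun r => (hF r).continuousAt
  -- Since h is only integrable, its primitive need not be differentiable everywhere; Fubini on the
  -- triangle r < u replaces the product rule. Integrating in r first produces the primitive of h;
  -- integrating in u first produces F b - F r.
  have hswap : ∫ u in a..b, ∫ r in a..b, (Ioi r).indicator (fun u => F' u (h r)) u =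
      ∫ r in a..b, ∫ u in a..b, (Ioi r).indicator (fun u => F' u (h r)) u := by
    apply intervalIntegral_intervalIntegral_swap
    have hm : MeasurableSet {x : ℝ × ℝ | x.2 < x.1} :=
      measurableSet_lt measurable_snd measurable_fst
    have key : IntegrableOn (fun x : ℝ × ℝ => F' x.1 (h x.2)) (uIoc a b ×ˢ uIoc a b) := by
      have hF'i : IntegrableOn F' (uIoc a b) :=
        intervalIntegrable_iff.1 (hF'.intervalIntegrable a b)
      have hhi : IntegrableOn h (uIoc a b) := intervalIntegrable_iff.1 hh
      unfold IntegrableOn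
      rw [Measure.volume_eq_prod, ← Measure.prod_restrict]
      refine Integrable.mono' (hF'i.norm.mul_prod hhi.norm) ?_ ?_
      · exact (ContinuousLinearMap.id ℝ (E →L[ℝ] E)).aestronglyMeasurable_comp₂
          hF'i.aestronglyMeasurable.comp_fst hhi.aestronglyMeasurable.comp_snd
      · exact Filter.Eventually.of_forall fun x => (F' x.1).le_opNorm (h x.2)
    refine (key.indicator hm).congr (Filter.Eventually.of_forall fun x => ?_)
    simp [Function.uncurry, indicator]
  have h1 : ∫ u in a..b, ∫ r in a..b, (Ioi r).indicator (fun u => F' u (h r)) u =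
      ∫ u in a..b, F' u (∫ r in a..u, h r) := by
    apply intervalIntegral.integral_congr
    intro u hu
    rw [uIcc_of_le hab] at hu
    have hhu : IntervalIntegrable h volume a u := hh.mono_set (by
      rw [uIcc_of_le hab, uIcc_of_le hu.1]; exact Icc_subset_Icc_right hu.2)
    simp only
    rw [← ContinuousLinearMap.intervalIntegral_comp_comm _ hhu,
      intervalIntegral.integral_of_le hab, intervalIntegral.integral_of_le hu.1]
    have : (fun r => (Ioi r).indicator (fun u => F' u (h r)) u) =
        (Iio u).indicator fun r => F' u (h r) := by
      ext r; simp [indicator]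
    rw [this, setIntegral_indicator measurableSet_Iio]
    rw [show Ioc a b ∩ Iio u = Ioo a u by
      ext r; simp only [mem_inter_iff, mem_Ioc, mem_Iio, mem_Ioo]
      exact ⟨fun h => ⟨h.1.1, h.2⟩, fun h => ⟨⟨h.1, h.2.le.trans hu.2⟩, h.2⟩⟩]
    exact (integral_Ioc_eq_integral_Ioo).symm
  have h2 : ∫ r in a..b, ∫ u in a..b, (Ioi r).indicator (fun u => F' u (h r)) u =
      ∫ r in a..b, (F b (h r) - F r (h r)) := by
    apply intervalIntegral.integral_congr
    intro r hr
    rw [uIcc_of_le hab] at hr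
    simp only
    rw [intervalIntegral.integral_of_le hab, setIntegral_indicator measurableSet_Ioi,
      show Ioc a b ∩ Ioi r = Ioc r b by
        ext u; simp only [mem_inter_iff, mem_Ioc, mem_Ioi]
        exact ⟨fun h => ⟨h.2, h.1.2⟩, fun h => ⟨⟨hr.1.trans_lt h.1, h.2⟩, h.1⟩⟩,
      ← intervalIntegral.integral_of_le hr.2]
    apply intervalIntegral.integral_eq_sub_of_hasDerivAt (f := fun u => F u (h r))
    · intro u _
      simpa using (hF u).clm_apply (hasDerivAt_const u (h r))
    · exact (hF'.clm_apply continuous_const).intervalIntegrable _ _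
  have hi1 : IntervalIntegrable (fun r => F b (h r)) volume a b :=
    intervalIntegrable_clm_comp (F b) hh
  have hi2 := intervalIntegrable_clm_apply hFc hh
  rw [h1, h2, intervalIntegral.integral_sub hi1 hi2,
    ContinuousLinearMap.intervalIntegral_comp_comm _ hh] at hswap
  rw [hswap]; abel

theorem continuous_exp_smul (A : E →L[ℝ] E) : Continuous fun t : ℝ => NormedSpace.exp (t • A) :=
  continuous_iff_continuousAt.2 fun t => (hasDerivAt_exp_smul_const A t).continuousAt

theorem exp_add_smul_apply (A : E →L[ℝ] E) (s t : ℝ) (x : E) :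
    NormedSpace.exp ((s + t) • A) x = NormedSpace.exp (s • A) (NormedSpace.exp (t • A) x) := by
  let := NormedAlgebra.restrictScalars ℚ ℝ (E →L[ℝ] E)
  rw [add_smul, NormedSpace.exp_add_of_commute]
  · rfl
  · exact ((Commute.refl A).smul_left s).smul_right t

/-- Variation of constants for the integrated equation `X' = A X + h`, `h` integrable. -/
theorem duhamel (A : E →L[ℝ] E) {X h : ℝ → E} {a b : ℝ} (hab : a ≤ b)
    (hX : ContinuousOn X (Icc a b)) (hh : IntervalIntegrable h volume a b)
    (hs : ∀ t ∈ Icc a b, X t = X a + ∫ s in a..t, (A (X s) + h s)) :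
    X b = NormedSpace.exp ((b - a) • A) (X a) +
      ∫ r in a..b, NormedSpace.exp ((b - r) • A) (h r) := by
  have hF : ∀ r, HasDerivAt (fun r => NormedSpace.exp ((b - r) • A))
      (-(NormedSpace.exp ((b - r) • A) * A)) r := by
    intro r
    have := (hasDerivAt_exp_smul_const A (b - r)).scomp r ((hasDerivAt_id r).const_sub b)
    simpa [Function.comp_def] using this
  have hFc : Continuous fun r => NormedSpace.exp ((b - r) • A) :=
    (continuous_exp_smul A).comp (continuous_const.sub continuous_id)
  have hF'c : Continuous fun r => -(NormedSpace.exp ((b - r) • A) * A) :=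
    (hFc.mul continuous_const).neg
  have hAX : IntervalIntegrable (fun r => A (X r)) volume a b := by
    apply ContinuousOn.intervalIntegrable
    rw [uIcc_of_le hab]
    exact A.continuous.comp_continuousOn hX
  -- The integrand A X + h has primitive X(t) - X(a), and the derivative of exp((b-r)A) brings out a
  -- factor -A, so the terms exp((b-r)A) A X(r) cancel.
  have hibp := integral_clm_apply_eq_sub hab hF hF'c (hAX.add hh)
  have hk : ∀ t ∈ Icc a b, ∫ s in a..t, (A (X s) + h s) = X t - X a := fun t ht => by
    rw [hs t ht]; abel
  have e1 : ∫ u in a..b, (-(NormedSpace.exp ((b - u) • A) * A)) (∫ r in a..u, (A (X r) + h r)) =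
      ∫ u in a..b, (-(NormedSpace.exp ((b - u) • A) (A (X u))) +
        (NormedSpace.exp ((b - u) • A) * A) (X a)) := by
    apply intervalIntegral.integral_congr
    intro u hu
    rw [uIcc_of_le hab] at hu
    simp only [hk u hu, map_sub, neg_apply, mul_apply_eq_comp]
    abel
  have e2 : ∫ u in a..b, (NormedSpace.exp ((b - u) • A) * A) (X a) =
      NormedSpace.exp ((b - a) • A) (X a) - X a := by
    rw [intervalIntegral.integral_eq_sub_of_hasDerivAt
      (f := fun u => -(NormedSpace.exp ((b - u) • A) (X a)))
      (f' := fun u => (NormedSpace.exp ((b - u) • A) * A) (X a))]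
    · simp; abel
    · intro u _
      simpa using ((hF u).clm_apply (hasDerivAt_const u (X a))).fun_neg
    · exact ((hFc.mul continuous_const).clm_apply continuous_const).intervalIntegrable _ _
  have i1 := intervalIntegrable_clm_apply hFc hAX
  have i2 := intervalIntegrable_clm_apply hFc hh
  have e3 : ∫ r in a..b, NormedSpace.exp ((b - r) • A) (A (X r) + h r) =
      (∫ r in a..b, NormedSpace.exp ((b - r) • A) (A (X r))) +
        ∫ r in a..b, NormedSpace.exp ((b - r) • A) (h r) := by
    rw [← intervalIntegral.integral_add i1 i2]
    simp only [map_add]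
  have i3 : IntervalIntegrable (fun u => (NormedSpace.exp ((b - u) • A) * A) (X a)) volume a b :=
    ((hFc.mul continuous_const).clm_apply continuous_const).intervalIntegrable _ _
  have i1' : IntervalIntegrable (fun u => -(NormedSpace.exp ((b - u) • A) (A (X u)))) volume a b :=
    i1.neg
  rw [e1, intervalIntegral.integral_add i1' i3, e2, hk b (right_mem_Icc.2 hab),
    intervalIntegral.integral_neg, e3] at hibp
  simp only [sub_self, zero_smul, NormedSpace.exp_zero, one_apply_eq_self] at hibp
  have := sub_eq_zero.2 hibp
  rw [← sub_eq_zero, ← neg_eq_zero, ← this]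
  abel

end Duhamel

/-! ### Decay of the exponential of a Hurwitz matrix -/

section HurwitzDecay

open Filter Topology

theorem exp_apply_of_eigenvector {V : Type*} [NormedAddCommGroup V] [NormedSpace ℂ V]
    [CompleteSpace V] (a : V →L[ℂ] V) {z : ℂ} {v : V} (h : a v = z • v) :
    NormedSpace.exp a v = Complex.exp z • v := by
  have hpow : ∀ n : ℕ, (a ^ n) v = z ^ n • v := by
    intro n
    induction n with
    | zero => simp
    | succ n ih => rw [pow_succ, mul_apply_eq_comp, h, map_smul, ih, smul_smul, pow_succ, mul_comm]
  have h1 := (NormedSpace.exp_series_hasSum_exp' (𝕂 := ℂ) a).mapL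
    (ContinuousLinearMap.apply ℂ V v)
  have h2 := (NormedSpace.exp_series_hasSum_exp' (𝕂 := ℂ) z).smul_const v
  rw [← Complex.exp_eq_exp_ℂ] at h2
  refine (h1.congr_fun ?_).unique h2
  intro n
  simp [hpow, smul_smul]

/-- Since a commutes with exp a, it preserves the μ-eigenspace of exp a. Over ℂ it has an
eigenvector there, and exp a acts on that vector both as μ and as exp z. -/
theorem exists_eigenvalue_of_mem_spectrum_exp {V : Type*} [NormedAddCommGroup V]
    [NormedSpace ℂ V] [FiniteDimensional ℂ V] (a : V →L[ℂ] V) {μ : ℂ}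
    (hμ : μ ∈ spectrum ℂ (NormedSpace.exp a)) :
    ∃ z : ℂ, Module.End.HasEigenvalue (a : V →ₗ[ℂ] V) z ∧ μ = Complex.exp z := by
  have : CompleteSpace V := FiniteDimensional.complete ℂ V
  set g : Module.End ℂ V := ((NormedSpace.exp a : V →L[ℂ] V) : V →ₗ[ℂ] V) with hg
  have hev : Module.End.HasEigenvalue g μ := by
    rw [Module.End.hasEigenvalue_iff_mem_spectrum]
    intro hu
    apply hμ
    have hb : Function.Bijective (algebraMap ℂ (Module.End ℂ V) μ - g) :=
      (Module.End.isUnit_iff _).1 hu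
    have : IsUnit (algebraMap ℂ (V →L[ℂ] V) μ - NormedSpace.exp a) := by
      rw [ContinuousLinearMap.isUnit_iff_bijective]
      exact hb
    exact this
  set f : Module.End ℂ V := (a : V →ₗ[ℂ] V) with hf
  have hcomm : Commute f g := by
    have h1 : Commute a (NormedSpace.exp a) := (Commute.refl a).exp_right
    ext x
    exact DFunLike.congr_fun h1.eq x
  have hmaps : ∀ x ∈ g.eigenspace μ, f x ∈ g.eigenspace μ :=
    Module.End.mapsTo_genEigenspace_of_comm hcomm.symm μ 1
  have : Nontrivial (g.eigenspace μ) := Submodule.nontrivial_iff_ne_bot.2 hev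
  obtain ⟨z, hz⟩ := Module.End.exists_eigenvalue (f.restrict hmaps)
  obtain ⟨w, hw⟩ := hz.exists_hasEigenvector
  have hw0 : (w : V) ≠ 0 := fun h => hw.2 (Subtype.ext h)
  have hfw : a w = z • (w : V) := congrArg Subtype.val hw.apply_eq_smul
  refine ⟨z, Module.End.hasEigenvalue_of_hasEigenvector (x := (w : V))
    ⟨Module.End.mem_eigenspace_iff.2 hfw, hw0⟩, ?_⟩
  have h1 : NormedSpace.exp a (w : V) = μ • (w : V) := Module.End.mem_eigenspace_iff.1 w.2
  rw [exp_apply_of_eigenvector a hfw] at h1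
  exact (smul_left_injective ℂ hw0 h1).symm

/-- By compactness of the spectrum the spectral radius is below some r < 1, and Gelfand's formula
then gives ‖b ^ n‖ ≤ r ^ n for large n. -/
theorem tendsto_pow_zero_of_spectrum_norm_lt_one {R : Type*} [NormedRing R] [NormedAlgebra ℂ R]
    [CompleteSpace R] (b : R) (h : ∀ z ∈ spectrum ℂ b, ‖z‖ < 1) :
    Tendsto (fun n : ℕ => b ^ n) atTop (𝓝 0) := by
  rcases subsingleton_or_nontrivial R with hR | hR
  · exact tendsto_const_nhds.congr fun n => Subsingleton.elim _ _
  have h1 : spectralRadius ℂ b < (1 : NNReal) :=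
    spectrum.spectralRadius_lt_of_forall_lt b fun z hz => by exact_mod_cast h z hz
  obtain ⟨r, hr0, hr1⟩ := ENNReal.lt_iff_exists_nnreal_btwn.1 h1
  have hr1' : r < 1 := by exact_mod_cast hr1
  have h2 := (spectrum.pow_nnnorm_pow_one_div_tendsto_nhds_spectralRadius b).eventually
    (gt_mem_nhds hr0)
  rw [tendsto_zero_iff_norm_tendsto_zero]
  refine squeeze_zero' (Eventually.of_forall fun n => norm_nonneg _) ?_
    (tendsto_pow_atTop_nhds_zero_of_lt_one r.2 hr1')
  filter_upwards [h2, eventually_gt_atTop 0] with n hn hn0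
  have hn' : (0 : ℝ) < n := by exact_mod_cast hn0
  have h3 : (‖b ^ n‖₊ : ENNReal) ≤ (r : ENNReal) ^ n := by
    have := ENNReal.rpow_le_rpow hn.le hn'.le
    rwa [← ENNReal.rpow_mul, one_div, inv_mul_cancel₀ hn'.ne', ENNReal.rpow_one,
      ENNReal.rpow_natCast] at this
  exact_mod_cast h3

/-- The complexification of a real matrix, regarded as an operator on `ℂ^q`. -/
noncomputable def complexify (q : ℕ) :
    SysMat q →+* (EuclideanSpace ℂ (Fin q) →L[ℂ] EuclideanSpace ℂ (Fin q)) :=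
  ((Matrix.toEuclideanCLM (n := Fin q) (𝕜 := ℂ)).toRingEquiv.toRingHom.comp
    (algebraMap ℝ ℂ).mapMatrix).comp
      (Matrix.toEuclideanCLM (n := Fin q) (𝕜 := ℝ)).symm.toRingEquiv.toRingHom

theorem complexify_smul {q : ℕ} (c : ℝ) (x : SysMat q) :
    complexify q (c • x) = c • complexify q x := by
  have h1 : (Matrix.toEuclideanCLM (n := Fin q) (𝕜 := ℝ)).symm (c • x) =
      c • (Matrix.toEuclideanCLM (n := Fin q) (𝕜 := ℝ)).symm x := map_smul _ c x
  have h2 : ∀ M : Matrix (Fin q) (Fin q) ℝ, (algebraMap ℝ ℂ).mapMatrix (c • M) =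
      (c : ℂ) • (algebraMap ℝ ℂ).mapMatrix M := fun M => by ext i j; simp
  change Matrix.toEuclideanCLM (n := Fin q) (𝕜 := ℂ) ((algebraMap ℝ ℂ).mapMatrix
    ((Matrix.toEuclideanCLM (n := Fin q) (𝕜 := ℝ)).symm (c • x))) = _
  rw [h1, h2, map_smul]
  rfl

theorem complexify_injective (q : ℕ) : Function.Injective (complexify q) := by
  refine (Matrix.toEuclideanCLM (n := Fin q) (𝕜 := ℂ)).injective.comp
    (Function.Injective.comp ?_ (Matrix.toEuclideanCLM (n := Fin q) (𝕜 := ℝ)).symm.injective)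
  exact Matrix.map_injective (algebraMap ℝ ℂ).injective

/-- Both sides are the characteristic polynomial of the same matrix. This turns the Hurwitz
condition into a statement on the eigenvalues of a complex operator. -/
theorem complexify_charpoly {q : ℕ} (x : SysMat q) :
    LinearMap.charpoly (complexify q x : EuclideanSpace ℂ (Fin q) →ₗ[ℂ] EuclideanSpace ℂ (Fin q)) =
    (LinearMap.charpoly (x : StateSpace q →ₗ[ℝ] StateSpace q)).map (algebraMap ℝ ℂ) := by
  have key : ∀ (𝕜 : Type) [RCLike 𝕜] (M : Matrix (Fin q) (Fin q) 𝕜),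
      LinearMap.charpoly (Matrix.toEuclideanCLM (n := Fin q) (𝕜 := 𝕜) M :
        EuclideanSpace 𝕜 (Fin q) →ₗ[𝕜] EuclideanSpace 𝕜 (Fin q)) = M.charpoly := by
    intro 𝕜 _ M
    rw [Matrix.coe_toEuclideanCLM_eq_toEuclideanLin, Matrix.toEuclideanLin_eq_toLin_orthonormal,
      Matrix.charpoly_toLin]
  obtain ⟨M, rfl⟩ : ∃ M, Matrix.toEuclideanCLM (n := Fin q) (𝕜 := ℝ) M = x :=
    ⟨_, StarAlgEquiv.apply_symm_apply _ x⟩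
  rw [key ℝ M, ← Matrix.charpoly_map, ← key ℂ]
  change LinearMap.charpoly (Matrix.toEuclideanCLM (n := Fin q) (𝕜 := ℂ)
    ((algebraMap ℝ ℂ).mapMatrix ((Matrix.toEuclideanCLM (n := Fin q) (𝕜 := ℝ)).symm
      (Matrix.toEuclideanCLM (n := Fin q) (𝕜 := ℝ) M))) : EuclideanSpace ℂ (Fin q) →ₗ[ℂ] _) = _
  rw [StarAlgEquiv.symm_apply_apply]
  rfl

/-- Complexification is an injective real-linear map between finite-dimensional spaces, hence a
closed embedding, and as a continuous ring homomorphism it commutes with exp. Convergence can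
therefore be checked over ℂ, where the spectrum of exp H consists of numbers exp z with Re z < 0. -/
theorem IsHurwitz.tendsto_exp_pow {q : ℕ} {H : SysMat q} (hH : IsHurwitz H) :
    Tendsto (fun n : ℕ => NormedSpace.exp H ^ n) atTop (𝓝 0) := by
  let φ : SysMat q →ₗ[ℝ] (EuclideanSpace ℂ (Fin q) →L[ℂ] EuclideanSpace ℂ (Fin q)) :=
    { toFun := complexify q
      map_add' := map_add _
      map_smul' := complexify_smul }
  have hemb : Topology.IsClosedEmbedding φ :=
    LinearMap.isClosedEmbedding_of_injective (LinearMap.ker_eq_bot.2 (complexify_injective q))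
  have hpow : Tendsto (fun n : ℕ => NormedSpace.exp (complexify q H) ^ n) atTop (𝓝 0) := by
    apply tendsto_pow_zero_of_spectrum_norm_lt_one
    intro μ hμ
    obtain ⟨z, hz, rfl⟩ := exists_eigenvalue_of_mem_spectrum_exp _ hμ
    rw [Module.End.hasEigenvalue_iff_isRoot_charpoly, complexify_charpoly] at hz
    rw [Complex.norm_exp, Real.exp_lt_one_iff]
    exact hH z hz
  rw [hemb.isInducing.tendsto_nhds_iff, map_zero]
  refine hpow.congr fun n => ?_
  let := NormedAlgebra.restrictScalars ℚ ℝ (SysMat q)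
  let := NormedAlgebra.restrictScalars ℚ ℝ
    (EuclideanSpace ℂ (Fin q) →L[ℂ] EuclideanSpace ℂ (Fin q))
  rw [← NormedSpace.map_exp (complexify q) hemb.continuous, ← map_pow]
  rfl

theorem exp_smul_eq_mul_pow {R : Type*} [NormedRing R] [NormedAlgebra ℝ R] [CompleteSpace R]
    (a : R) (t : ℝ) (n : ℕ) :
    NormedSpace.exp (t • a) = NormedSpace.exp ((t - n) • a) * NormedSpace.exp a ^ n := by
  let := NormedAlgebra.restrictScalars ℚ ℝ R
  rw [← NormedSpace.exp_nsmul, ← NormedSpace.exp_add_of_commute]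
  · rw [← Nat.cast_smul_eq_nsmul ℝ, ← add_smul, sub_add_cancel]
  · rw [← Nat.cast_smul_eq_nsmul ℝ]
    exact ((Commute.refl a).smul_left _).smul_right _

theorem IsHurwitz.tendsto_exp_smul {q : ℕ} {H : SysMat q} (hH : IsHurwitz H) :
    Tendsto (fun t : ℝ => NormedSpace.exp (t • H)) atTop (𝓝 0) := by
  obtain ⟨C, hC⟩ := (isCompact_Icc (a := (0 : ℝ)) (b := 1)).exists_bound_of_continuousOn
    (continuous_exp_smul H).continuousOn
  have h0 : Tendsto (fun t : ℝ => C * ‖NormedSpace.exp H ^ ⌊t⌋₊‖) atTop (𝓝 0) := by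
    simpa using ((hH.tendsto_exp_pow.comp tendsto_nat_floor_atTop).norm).const_mul C
  refine squeeze_zero_norm' ?_ h0
  filter_upwards [eventually_ge_atTop 0] with t ht
  -- The remainder t - ⌊t⌋ lies in [0, 1], where the exponential is bounded by C; the integer power
  -- carries the decay.
  rw [exp_smul_eq_mul_pow H t ⌊t⌋₊]
  refine (norm_mul_le _ _).trans (mul_le_mul_of_nonneg_right (hC _ ⟨?_, ?_⟩) (norm_nonneg _))
  · linarith [Nat.floor_le ht]
  · linarith [Nat.lt_floor_add_one t]

end HurwitzDecay

/-! ### Perturbations of the nominal predictor loop -/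

section PerturbedLoop

open Filter Topology

variable {E : Type*} [NormedAddCommGroup E]

/-- The size of the state of a system with input delay `D` at time `t`, with the input segment
measured in `L¹`. -/
noncomputable def delaySize (D : ℝ) (X : ℝ → E) (U : ℝ → ℝ) (t : ℝ) : ℝ :=
  ‖X t‖ + ∫ θ in (t - D)..t, |U θ|

theorem delaySize_nonneg {D : ℝ} {X : ℝ → E} {U : ℝ → ℝ} (hD : 0 ≤ D) (t : ℝ) :
    0 ≤ delaySize D X U t :=
  add_nonneg (norm_nonneg _)
    (intervalIntegral.integral_nonneg (by linarith) fun _ _ => abs_nonneg _)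

theorem norm_le_delaySize {D : ℝ} {X : ℝ → E} {U : ℝ → ℝ} (hD : 0 ≤ D) (t : ℝ) :
    ‖X t‖ ≤ delaySize D X U t :=
  le_add_of_nonneg_right (intervalIntegral.integral_nonneg (by linarith) fun _ _ => abs_nonneg _)

variable [NormedSpace ℝ E]

/-- The prediction at time `t` of the state at time `t + D` of `X' = A X + U(t - D) B`. -/
noncomputable def nominalPredictor (A : E →L[ℝ] E) (B : E) (D : ℝ) (X : ℝ → E) (U : ℝ → ℝ)
    (t : ℝ) : E :=
  NormedSpace.exp (D • A) (X t) + ∫ θ in (t - D)..t, NormedSpace.exp ((t - θ) • A) (U θ • B)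

/-- `(X, U)` solves a perturbation of size `δ`, with forcing term `f`, of the nominal predictor
feedback loop. -/
structure IsPerturbedLoop (A : E →L[ℝ] E) (B : E) (K : E →L[ℝ] ℝ) (D c δ : ℝ)
    (X : ℝ → E) (U : ℝ → ℝ) (f : ℝ → E) : Prop where
  continuousOn : ContinuousOn X (Ici 0)
  integrable_input : ∀ T, 0 ≤ T → IntervalIntegrable U volume (-D) T
  integrable_forcing : ∀ T, 0 ≤ T → IntervalIntegrable f volume 0 T
  plant : ∀ t, 0 ≤ t → X t = X 0 + ∫ r in (0 : ℝ)..t, (A (X r) + (U (r - D) • B + f r))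
  forcing_le : ∀ r, 0 ≤ r → ‖f r‖ ≤ δ * (‖X r‖ + |U (r - D)|)
  input_le : ∀ t, 0 ≤ t → |U t| ≤ c * delaySize D X U t
  control : ∀ t, 0 ≤ t → |U t - K (nominalPredictor A B D X U t)| ≤ δ * delaySize D X U t

namespace IsPerturbedLoop

variable {A : E →L[ℝ] E} {B : E} {K : E →L[ℝ] ℝ} {D c δ : ℝ} {X : ℝ → E} {U : ℝ → ℝ}
  {f : ℝ → E}

theorem intervalIntegrable_input (h : IsPerturbedLoop A B K D c δ X U f) {s t : ℝ}
    (hs : -D ≤ s) (ht : -D ≤ t) : IntervalIntegrable U volume s t := by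
  rcases le_total D 0 with hD | hD
  · exact (h.integrable_input s (by linarith)).symm.trans (h.integrable_input t (by linarith))
  · refine (h.integrable_input (max 0 (max s t)) (le_max_left _ _)).mono_set ?_
    rw [uIcc_of_le (a := -D) ((by linarith : -D ≤ 0).trans (le_max_left _ _))]
    exact uIcc_subset_Icc ⟨hs, by simp⟩ ⟨ht, by simp⟩

theorem intervalIntegrable_delayed (h : IsPerturbedLoop A B K D c δ X U f) {s t : ℝ}
    (hs : 0 ≤ s) (ht : 0 ≤ t) : IntervalIntegrable (fun r => U (r - D)) volume s t := by
  have := (h.intervalIntegrable_input (s := s - D) (t := t - D)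
    (by linarith) (by linarith)).comp_sub_right D
  simpa using this

theorem intervalIntegrable_forcing (h : IsPerturbedLoop A B K D c δ X U f) {s t : ℝ}
    (hs : 0 ≤ s) (ht : 0 ≤ t) : IntervalIntegrable f volume s t :=
  (h.integrable_forcing s hs).symm.trans (h.integrable_forcing t ht)

theorem intervalIntegrable_state (h : IsPerturbedLoop A B K D c δ X U f) {s t : ℝ}
    (hs : 0 ≤ s) (ht : 0 ≤ t) : IntervalIntegrable X volume s t :=
  (h.continuousOn.mono fun _ hx => (le_min hs ht).trans hx.1).intervalIntegrable

theorem intervalIntegrable_source (h : IsPerturbedLoop A B K D c δ X U f) {s t : ℝ}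
    (hs : 0 ≤ s) (ht : 0 ≤ t) :
    IntervalIntegrable (fun r => U (r - D) • B + f r) volume s t :=
  (intervalIntegrable_smul_const (h.intervalIntegrable_delayed hs ht) B).add
    (h.intervalIntegrable_forcing hs ht)

theorem plant_from (h : IsPerturbedLoop A B K D c δ X U f) {s t : ℝ} (hs : 0 ≤ s) (hst : s ≤ t) :
    X t = X s + ∫ r in s..t, (A (X r) + (U (r - D) • B + f r)) := by
  have hi : ∀ {s t : ℝ}, 0 ≤ s → 0 ≤ t →
      IntervalIntegrable (fun r => A (X r) + (U (r - D) • B + f r)) volume s t := fun hs ht =>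
    (intervalIntegrable_clm_comp A (h.intervalIntegrable_state hs ht)).add
      (h.intervalIntegrable_source hs ht)
  rw [h.plant t (hs.trans hst), h.plant s hs, add_assoc,
    intervalIntegral.integral_add_adjacent_intervals (hi le_rfl hs) (hi hs (hs.trans hst))]

theorem integral_abs_delayed (s t : ℝ) :
    ∫ r in s..t, |U (r - D)| = ∫ r in (s - D)..(t - D), |U r| :=
  intervalIntegral.integral_comp_sub_right (fun r => |U r|) D

theorem input_integral_mono (h : IsPerturbedLoop A B K D c δ X U f) {a b s t : ℝ}
    (ha : -D ≤ a) (has : a ≤ s) (hst : s ≤ t) (htb : t ≤ b) :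
    ∫ r in s..t, |U r| ≤ ∫ r in a..b, |U r| :=
  intervalIntegral.integral_mono_interval has hst htb
    (Eventually.of_forall fun _ => abs_nonneg _)
    (h.intervalIntegrable_input ha (ha.trans (has.trans (hst.trans htb)))).abs

/-- The state size grows at most by a fixed factor over a bounded time. -/
theorem delaySize_le (h : IsPerturbedLoop A B K D c δ X U f) (hD : 0 ≤ D) (hc : 0 ≤ c)
    (hδ : δ ≤ 1) {s t L : ℝ} (hs : 0 ≤ s) (hst : s ≤ t) (htL : t ≤ s + L) :
    delaySize D X U t ≤
      (‖B‖ + 2) * Real.exp ((‖A‖ + 1 + (‖B‖ + 2) * c) * L) * delaySize D X U s := by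
  -- The left end of the input window is frozen at s - D. Thus z is continuous, dominates the state
  -- size after s, and also controls every delayed input that reaches the plant.
  set z : ℝ → ℝ := fun r => ‖X r‖ + ∫ θ in (s - D)..r, |U θ| with hz
  have hsize : ∀ r, s ≤ r → delaySize D X U r ≤ z r := fun r hr => by
    simp only [delaySize, hz]
    gcongr
    exact h.input_integral_mono (by linarith) (by linarith) (by linarith) le_rfl
  have hzc : ContinuousOn z (Icc s t) := by
    refine ContinuousOn.add ?_ ?_
    · exact (h.continuousOn.mono fun r hr => hs.trans hr.1).norm
    · have hi : IntervalIntegrable (fun θ => |U θ|) volume (s - D) t :=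
        (h.intervalIntegrable_input (by linarith) (by linarith)).abs
      have := intervalIntegral.continuousOn_primitive_interval' hi
        (left_mem_uIcc : s - D ∈ uIcc (s - D) t)
      refine this.mono ?_
      rw [uIcc_of_le (by linarith)]
      exact Icc_subset_Icc_left (by linarith)
  have hz0 : ∀ r, s ≤ r → 0 ≤ z r := fun r hr => (delaySize_nonneg hD r).trans (hsize r hr)
  have hzs : z s = delaySize D X U s := rfl
  -- In C₁, ‖A‖ + 1 comes from the drift and the forcing (as δ ≤ 1). New inputs satisfy |U| ≤ c z
  -- and count ‖B‖ + 1 times through the plant and once in z itself, hence (‖B‖ + 2)c. The input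
  -- stored at time s is counted the same way, hence ‖B‖ + 2 in C₀.
  have key := gronwall_integral (z := z) (a := s) (b := t) (C₀ := (‖B‖ + 2) * z s)
    (C₁ := ‖A‖ + 1 + (‖B‖ + 2) * c) (by positivity) hzc ?_ t (right_mem_Icc.2 hst)
  · calc delaySize D X U t ≤ z t := hsize t hst
      _ ≤ _ := key
      _ ≤ (‖B‖ + 2) * z s * Real.exp ((‖A‖ + 1 + (‖B‖ + 2) * c) * L) := by
        have := hz0 s le_rfl
        gcongr
        linarith
      _ = _ := by rw [hzs]; ring
  intro r hr
  have hr0 : 0 ≤ r := hs.trans hr.1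
  have hzi : IntervalIntegrable z volume s r := by
    apply ContinuousOn.intervalIntegrable
    rw [uIcc_of_le hr.1]
    exact hzc.mono (Icc_subset_Icc_right hr.2)
  have hUi : IntervalIntegrable (fun θ => |U θ|) volume s r :=
    (h.intervalIntegrable_input (by linarith) (by linarith)).abs
  have hXi := (h.intervalIntegrable_state hs hr0).norm
  have hdi := (h.intervalIntegrable_delayed hs hr0).abs
  have hU : ∫ θ in s..r, |U θ| ≤ c * ∫ θ in s..r, z θ := by
    rw [← intervalIntegral.integral_const_mul]
    refine intervalIntegral.integral_mono_on hr.1 hUi (hzi.const_mul c) fun θ hθ => ?_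
    exact (h.input_le θ (hs.trans hθ.1)).trans (mul_le_mul_of_nonneg_left (hsize θ hθ.1) hc)
  have hXz : ∫ θ in s..r, ‖X θ‖ ≤ ∫ θ in s..r, z θ :=
    intervalIntegral.integral_mono_on hr.1 hXi hzi fun θ hθ =>
      (norm_le_delaySize hD θ).trans (hsize θ hθ.1)
  have hX : ‖X r‖ ≤ ‖X s‖ + ((‖A‖ + 1) * (∫ θ in s..r, ‖X θ‖) +
      (‖B‖ + 1) * ∫ θ in s..r, |U (θ - D)|) := by
    rw [h.plant_from hs hr.1, ← intervalIntegral.integral_const_mul,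
      ← intervalIntegral.integral_const_mul, ← intervalIntegral.integral_add
        (hXi.const_mul _) (hdi.const_mul _)]
    refine (norm_add_le _ _).trans (add_le_add le_rfl ?_)
    refine intervalIntegral.norm_integral_le_of_norm_le hr.1 ?_
      ((hXi.const_mul _).add (hdi.const_mul _))
    refine Eventually.of_forall fun θ hθ => ?_
    have h1 : ‖f θ‖ ≤ ‖X θ‖ + |U (θ - D)| :=
      (h.forcing_le θ (hs.trans hθ.1.le)).trans (mul_le_of_le_one_left (by positivity) hδ)
    have h2 := A.le_opNorm (X θ)
    have h3 : ‖U (θ - D) • B‖ = |U (θ - D)| * ‖B‖ := norm_smul _ _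
    have h4 := norm_add_le (A (X θ)) (U (θ - D) • B + f θ)
    have h5 := norm_add_le (U (θ - D) • B) (f θ)
    linarith
  have hsplit : ∫ θ in (s - D)..r, |U θ| = (∫ θ in (s - D)..s, |U θ|) + ∫ θ in s..r, |U θ| :=
    (intervalIntegral.integral_add_adjacent_intervals
      (h.intervalIntegrable_input (by linarith) (by linarith)).abs hUi).symm
  have hdel : ∫ θ in s..r, |U (θ - D)| ≤ ∫ θ in (s - D)..r, |U θ| := by
    rw [integral_abs_delayed]
    exact h.input_integral_mono (by linarith) le_rfl (by linarith [hr.1]) (by linarith)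
  have hu0 : 0 ≤ ∫ θ in (s - D)..s, |U θ| :=
    intervalIntegral.integral_nonneg (by linarith) fun _ _ => abs_nonneg _
  have hzr : z r = ‖X r‖ + ∫ θ in (s - D)..r, |U θ| := rfl
  have hzs' : z s = ‖X s‖ + ∫ θ in (s - D)..s, |U θ| := rfl
  set I := ∫ θ in s..r, z θ
  set u₀ := ∫ θ in (s - D)..s, |U θ|
  have hB := norm_nonneg B
  have hA := norm_nonneg A
  have hXs := norm_nonneg (X s)
  have hW : ∫ θ in (s - D)..r, |U θ| ≤ u₀ + c * I := by rw [hsplit]; linarith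
  calc z r ≤ ‖X s‖ + ((‖A‖ + 1) * I + (‖B‖ + 1) * (u₀ + c * I)) + (u₀ + c * I) := by
        rw [hzr]
        refine add_le_add (hX.trans ?_) hW
        gcongr
        exact hdel.trans hW
    _ ≤ (‖B‖ + 2) * z s + (‖A‖ + 1 + (‖B‖ + 2) * c) * I := by
        rw [hzs']
        nlinarith [mul_nonneg hB hXs]

variable [CompleteSpace E]

/-- The nominal predictor and the true future state differ by a term of the size of the
perturbation. -/
theorem norm_state_sub_predictor_le (h : IsPerturbedLoop A B K D c δ X U f) (hD : 0 ≤ D)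
    (hδ : 0 ≤ δ) {M C : ℝ} (hM : ∀ s ∈ Icc 0 D, ‖NormedSpace.exp (s • A)‖ ≤ M) {t : ℝ}
    (ht : 0 ≤ t) (hC : ∀ r ∈ Icc t (t + D), delaySize D X U r ≤ C * delaySize D X U t) :
    ‖X (t + D) - nominalPredictor A B D X U t‖ ≤ δ * (M * (D * C + 1)) * delaySize D X U t := by
  have htD : 0 ≤ t + D := by linarith
  have hM0 : 0 ≤ M := (norm_nonneg _).trans (hM 0 ⟨le_rfl, hD⟩)
  have hcont : Continuous fun r => NormedSpace.exp ((t + D - r) • A) :=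
    (continuous_exp_smul A).comp (continuous_const.sub continuous_id)
  have hd := duhamel A (a := t) (b := t + D) (by linarith)
    (h.continuousOn.mono fun r hr => ht.trans hr.1) (h.intervalIntegrable_source ht htD)
    fun r hr => h.plant_from ht hr.1
  simp only [map_add] at hd
  rw [intervalIntegral.integral_add
    (intervalIntegrable_clm_apply hcont
      (intervalIntegrable_smul_const (h.intervalIntegrable_delayed ht htD) B))
    (intervalIntegrable_clm_apply hcont (h.intervalIntegrable_forcing ht htD))] at hd
  have hsub : ∫ r in t..(t + D), NormedSpace.exp ((t + D - r) • A) (U (r - D) • B) =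
      ∫ θ in (t - D)..t, NormedSpace.exp ((t - θ) • A) (U θ • B) := by
    have := intervalIntegral.integral_comp_sub_right (a := t) (b := t + D)
      (fun θ => NormedSpace.exp ((t - θ) • A) (U θ • B)) D
    rw [add_sub_cancel_right] at this
    rw [← this]
    congr 1
    ext r
    rw [show t + D - r = t - (r - D) by ring]
  -- The delayed inputs acting on [t, t+D] are exactly those stored on [t-D, t], so only the forcing
  -- escapes the prediction.
  have heq : X (t + D) - nominalPredictor A B D X U t =
      ∫ r in t..(t + D), NormedSpace.exp ((t + D - r) • A) (f r) := by
    rw [hd, hsub, nominalPredictor, show t + D - t = D by ring]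
    abel
  have hXi := (h.intervalIntegrable_state ht htD).norm
  have hdi := (h.intervalIntegrable_delayed ht htD).abs
  have hX : ∫ r in t..(t + D), ‖X r‖ ≤ D * C * delaySize D X U t := by
    have := intervalIntegral.integral_mono_on (by linarith) hXi
      (intervalIntegrable_const (c := C * delaySize D X U t)) fun r hr =>
        (norm_le_delaySize (U := U) hD r).trans (hC r hr)
    rw [intervalIntegral.integral_const, smul_eq_mul, add_sub_cancel_left] at this
    linarith
  have hU : ∫ r in t..(t + D), |U (r - D)| ≤ delaySize D X U t := by
    rw [integral_abs_delayed, add_sub_cancel_right]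
    exact le_add_of_nonneg_left (norm_nonneg _)
  rw [heq]
  calc ‖∫ r in t..(t + D), NormedSpace.exp ((t + D - r) • A) (f r)‖
      ≤ ∫ r in t..(t + D), M * δ * (‖X r‖ + |U (r - D)|) := by
        refine intervalIntegral.norm_integral_le_of_norm_le (by linarith) ?_
          ((hXi.add hdi).const_mul _)
        refine Eventually.of_forall fun r hr => ?_
        rw [mul_assoc]
        refine (ContinuousLinearMap.le_opNorm _ _).trans (mul_le_mul (hM _ ⟨?_, ?_⟩)
          (h.forcing_le r (ht.trans hr.1.le)) (norm_nonneg _) hM0)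
        · linarith [hr.2]
        · linarith [hr.1]
    _ = M * δ * ((∫ r in t..(t + D), ‖X r‖) + ∫ r in t..(t + D), |U (r - D)|) := by
        rw [intervalIntegral.integral_const_mul, intervalIntegral.integral_add hXi hdi]
    _ ≤ M * δ * (D * C * delaySize D X U t + delaySize D X U t) := by gcongr
    _ = _ := by ring

/-- The feedback uses the nominal predictor up to O(δ), and the predictor is the state one delay
later up to O(δ). This is what makes the delay disappear from the loop. -/
theorem abs_input_sub_gain_le (h : IsPerturbedLoop A B K D c δ X U f) (hD : 0 ≤ D)
    (hδ : 0 ≤ δ) {M C : ℝ} (hM : ∀ s ∈ Icc 0 D, ‖NormedSpace.exp (s • A)‖ ≤ M) {t : ℝ}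
    (ht : 0 ≤ t) (hC : ∀ r ∈ Icc t (t + D), delaySize D X U r ≤ C * delaySize D X U t) :
    |U t - K (X (t + D))| ≤ δ * (1 + ‖K‖ * (M * (D * C + 1))) * delaySize D X U t := by
  have h1 := h.control t ht
  have h2 := h.norm_state_sub_predictor_le hD hδ hM ht hC
  have h3 : |K (X (t + D) - nominalPredictor A B D X U t)| ≤
      ‖K‖ * (δ * (M * (D * C + 1)) * delaySize D X U t) :=
    (K.le_opNorm _).trans (mul_le_mul_of_nonneg_left h2 (norm_nonneg _))
  have h4 : U t - K (X (t + D)) = (U t - K (nominalPredictor A B D X U t)) -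
      K (X (t + D) - nominalPredictor A B D X U t) := by rw [map_sub]; ring
  rw [h4]
  refine (abs_sub _ _).trans ?_
  linarith

/-- After one delay the state follows `X' = (A + B K) X` up to a term of the size of the
perturbation. -/
theorem norm_state_le (h : IsPerturbedLoop A B K D c δ X U f) (hD : 0 ≤ D) (hc : 0 ≤ c)
    (hδ : 0 ≤ δ) {M C C' L M' : ℝ} (hM : ∀ s ∈ Icc 0 D, ‖NormedSpace.exp (s • A)‖ ≤ M)
    (hM' : ∀ s ∈ Icc 0 L, ‖NormedSpace.exp (s • (A + K.smulRight B))‖ ≤ M')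
    (hC : ∀ s t, 0 ≤ s → s ≤ t → t ≤ s + D → delaySize D X U t ≤ C * delaySize D X U s)
    (hC' : ∀ s t, 0 ≤ s → s ≤ t → t ≤ s + L → delaySize D X U t ≤ C' * delaySize D X U s)
    {s t : ℝ} (hs : 0 ≤ s) (hst : s + D ≤ t) (htL : t ≤ s + L) :
    ‖X t‖ ≤ (‖NormedSpace.exp ((t - (s + D)) • (A + K.smulRight B))‖ * C +
      δ * (L * (M' * ((1 + c) * C' + (1 + ‖K‖ * (M * (D * C + 1))) * C' * ‖B‖)))) *
        delaySize D X U s := by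
  have hsD : 0 ≤ s + D := by linarith
  have hL : 0 ≤ L := by linarith
  have ht : 0 ≤ t := by linarith
  have hN : 0 ≤ delaySize D X U s := delaySize_nonneg hD s
  have hM0 : 0 ≤ M' := (norm_nonneg _).trans (hM' 0 ⟨le_rfl, hL⟩)
  set H := A + K.smulRight B with hH
  -- Residual of the plant relative to X' = (A + BK)X. Its input part at r is small because the
  -- bound for the feedback applies at time r - D, which is at least s.
  set g : ℝ → E := fun r => f r + (U (r - D) - K (X r)) • B with hg
  have hKX : IntervalIntegrable (fun r => K (X r)) volume (s + D) t :=
    intervalIntegrable_clm_comp K (h.intervalIntegrable_state hsD ht)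
  have hgi : IntervalIntegrable g volume (s + D) t :=
    (h.intervalIntegrable_forcing hsD ht).add
      (intervalIntegrable_smul_const ((h.intervalIntegrable_delayed hsD ht).sub hKX) B)
  have hd := duhamel H hst (h.continuousOn.mono fun r hr => hsD.trans hr.1) hgi fun r hr => by
    rw [h.plant_from hsD hr.1]
    congr 2
    ext θ
    simp only [hH, hg, add_apply, ContinuousLinearMap.smulRight_apply, sub_smul]
    abel
  set C₂ := 1 + ‖K‖ * (M * (D * C + 1)) with hC₂
  -- No sign of C is assumed: the growth bound at t = s forces C ≥ 0 unless the size vanishes at s.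
  have hC0 : 0 ≤ C₂ ∨ delaySize D X U s = 0 := by
    rcases hN.eq_or_lt with h0 | h0
    · exact Or.inr h0.symm
    · left
      have hM0 : 0 ≤ M := (norm_nonneg _).trans (hM 0 ⟨le_rfl, hD⟩)
      have := hC s s hs le_rfl (by linarith)
      have : 0 ≤ C := by by_contra! hneg; nlinarith
      positivity
  have hgb : ∀ r ∈ Icc (s + D) t,
      ‖g r‖ ≤ δ * ((1 + c) * C' + C₂ * C' * ‖B‖) * delaySize D X U s := by
    intro r hr
    have hr0 : 0 ≤ r := hsD.trans hr.1
    have hrD : 0 ≤ r - D := by linarith [hr.1]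
    have hNr := hC' s r hs (by linarith [hr.1]) (hr.2.trans htL)
    have hNrD := hC' s (r - D) hs (by linarith [hr.1]) (by linarith [hr.2])
    have h1 := h.forcing_le r hr0
    have h2 := h.input_le (r - D) hrD
    have h3 := h.abs_input_sub_gain_le hD hδ hM hrD
      fun r' hr' => hC (r - D) r' hrD hr'.1 hr'.2
    rw [sub_add_cancel] at h3
    have h4 : ‖X r‖ + |U (r - D)| ≤ (1 + c) * C' * delaySize D X U s := by
      have := norm_le_delaySize (X := X) (U := U) hD r
      have := mul_le_mul_of_nonneg_left hNrD hc
      linarith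
    have h5 : |U (r - D) - K (X r)| ≤ δ * C₂ * C' * delaySize D X U s := by
      refine h3.trans ?_
      rcases hC0 with hC0 | hC0
      · rw [mul_assoc _ C']
        exact mul_le_mul_of_nonneg_left hNrD (by positivity)
      · rw [hC0, mul_zero] at hNrD
        rw [hC0, hNrD.antisymm (delaySize_nonneg hD _), mul_zero, mul_zero]
    calc ‖g r‖ ≤ ‖f r‖ + |U (r - D) - K (X r)| * ‖B‖ := by
          refine (norm_add_le _ _).trans ?_
          rw [norm_smul, Real.norm_eq_abs]
      _ ≤ δ * ((1 + c) * C' * delaySize D X U s) + δ * C₂ * C' * delaySize D X U s * ‖B‖ := by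
          gcongr
          exact h1.trans (mul_le_mul_of_nonneg_left h4 hδ)
      _ = _ := by ring
  set G := δ * ((1 + c) * C' + C₂ * C' * ‖B‖) * delaySize D X U s with hG
  have hG0 : 0 ≤ G := (norm_nonneg _).trans (hgb t (right_mem_Icc.2 hst))
  have hint : ‖∫ r in (s + D)..t, NormedSpace.exp ((t - r) • H) (g r)‖ ≤ L * (M' * G) := by
    have := intervalIntegral.norm_integral_le_of_norm_le_const (a := s + D) (b := t)
      (f := fun r => NormedSpace.exp ((t - r) • H) (g r)) (C := M' * G) fun r hr => by
        rw [uIoc_of_le hst] at hr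
        refine (ContinuousLinearMap.le_opNorm _ _).trans (mul_le_mul (hM' _ ⟨?_, ?_⟩)
          (hgb r ⟨hr.1.le, hr.2⟩) (norm_nonneg _) hM0)
        · linarith [hr.2]
        · linarith [hr.1]
    refine this.trans ?_
    rw [abs_of_nonneg (by linarith), mul_comm]
    exact mul_le_mul_of_nonneg_right (by linarith) (by positivity)
  have hXD : ‖X (s + D)‖ ≤ C * delaySize D X U s :=
    (norm_le_delaySize hD _).trans (hC s (s + D) hs (by linarith) le_rfl)
  rw [hd]
  refine (norm_add_le _ _).trans ?_
  have h6 : ‖NormedSpace.exp ((t - (s + D)) • H) (X (s + D))‖ ≤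
      ‖NormedSpace.exp ((t - (s + D)) • H)‖ * (C * delaySize D X U s) :=
    (ContinuousLinearMap.le_opNorm _ _).trans (mul_le_mul_of_nonneg_left hXD (norm_nonneg _))
  calc _ ≤ ‖NormedSpace.exp ((t - (s + D)) • H)‖ * (C * delaySize D X U s) + L * (M' * G) :=
        add_le_add h6 hint
    _ = _ := by rw [hG]; ring

end IsPerturbedLoop

end PerturbedLoop

/-! ### Exponential decay of small perturbations -/

open Filter Topology in
/-- A nonnegative quantity that halves over every period `T` and grows at most by the factor `C`
within a period decays exponentially. -/
theorem le_mul_exp_of_half {N : ℝ → ℝ} {T C : ℝ} (hT : 0 < T) (hC : 0 ≤ C)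
    (hhalf : ∀ s, 0 ≤ s → N (s + T) ≤ 1 / 2 * N s)
    (hgrow : ∀ s t, 0 ≤ s → s ≤ t → t ≤ s + T → N t ≤ C * N s) (hN : 0 ≤ N 0) {t : ℝ}
    (ht : 0 ≤ t) : N t ≤ 2 * C * N 0 * Real.exp (-(Real.log 2 / T) * t) := by
  have hpow : ∀ n : ℕ, N (n * T) ≤ (1 / 2) ^ n * N 0 := by
    intro n
    induction n with
    | zero => simp
    | succ n ih =>
      have := hhalf (n * T) (by positivity)
      rw [show ((n + 1 : ℕ) : ℝ) * T = n * T + T by push_cast; ring, pow_succ]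
      linarith
  set n := ⌊t / T⌋₊ with hn
  have h1 : n * T ≤ t := (le_div_iff₀ hT).1 (Nat.floor_le (by positivity))
  have h2 : t < (n + 1) * T := (div_lt_iff₀ hT).1 (Nat.lt_floor_add_one _)
  have h3 : N t ≤ C * ((1 / 2) ^ n * N 0) :=
    (hgrow (n * T) t (by positivity) h1 (by linarith)).trans
      (mul_le_mul_of_nonneg_left (hpow n) hC)
  have hlog : 0 < Real.log 2 := Real.log_pos one_lt_two
  -- The factor 2 pays for the incomplete last period, as t < (n+1)T.
  have h4 : ((1 : ℝ) / 2) ^ n ≤ 2 * Real.exp (-(Real.log 2 / T) * t) := by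
    rw [one_div, ← Real.exp_log (show (0 : ℝ) < 2⁻¹ by norm_num), ← Real.exp_nat_mul, Real.log_inv]
    nth_rewrite 2 [← Real.exp_log (zero_lt_two' ℝ)]
    rw [← Real.exp_add, Real.exp_le_exp]
    have h5 : Real.log 2 / T * t ≤ Real.log 2 * (n + 1) := by
      rw [div_mul_eq_mul_div, div_le_iff₀ hT, mul_assoc]
      exact mul_le_mul_of_nonneg_left h2.le hlog.le
    linarith
  calc N t ≤ C * ((1 / 2) ^ n * N 0) := h3
    _ ≤ C * (2 * Real.exp (-(Real.log 2 / T) * t) * N 0) := by gcongr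
    _ = _ := by ring

open Filter Topology in
/-- Robustness of predictor feedback: sufficiently small perturbations of a nominal loop with
`A + B K` exponentially stable are exponentially stable, uniformly in the perturbation. -/
theorem exists_perturbedLoop_decay {E : Type*} [NormedAddCommGroup E] [NormedSpace ℝ E]
    [CompleteSpace E] (A : E →L[ℝ] E) (B : E) (K : E →L[ℝ] ℝ) {D c : ℝ} (hD : 0 < D) (hc : 0 ≤ c)
    (hH : Tendsto (fun t : ℝ => NormedSpace.exp (t • (A + K.smulRight B))) atTop (𝓝 0)) :
    ∃ δ > (0 : ℝ), ∃ ρ > (0 : ℝ), ∃ ξ > (0 : ℝ), ∀ (X : ℝ → E) (U : ℝ → ℝ) (f : ℝ → E),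
      IsPerturbedLoop A B K D c δ X U f → ∀ t, 0 ≤ t →
        delaySize D X U t ≤ ρ * delaySize D X U 0 * Real.exp (-ξ * t) := by
  obtain ⟨M, hM⟩ := (isCompact_Icc (a := (0 : ℝ)) (b := D)).exists_bound_of_continuousOn
    (continuous_exp_smul A).continuousOn
  have hM0 : 0 ≤ M := (norm_nonneg _).trans (hM 0 ⟨le_rfl, hD.le⟩)
  let G : ℝ → ℝ := fun L => (‖B‖ + 2) * Real.exp ((‖A‖ + 1 + (‖B‖ + 2) * c) * L)
  have hG : ∀ L, 0 < G L := fun L => by positivity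
  set C := G D with hC
  have hC0 : 0 < C := hG D
  -- The target factor 1/2 is shared equally: 1/4 for the decayed nominal part, through κ, and 1/4
  -- for the perturbation, through δ. The weight 1 + D‖K‖ counts the state once and the input K X
  -- over a window of length D.
  set κ := 1 / (4 * ((1 + D * ‖K‖) * C)) with hκ
  have hκ0 : 0 < κ := by positivity
  obtain ⟨T₁, hT₁0, hT₁⟩ : ∃ T₁ : ℝ, 0 ≤ T₁ ∧
      ∀ s, T₁ ≤ s → ‖NormedSpace.exp (s • (A + K.smulRight B))‖ ≤ κ := by
    have h1 := (tendsto_zero_iff_norm_tendsto_zero.1 hH).eventually (ge_mem_nhds hκ0)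
    obtain ⟨T₁, hT₁⟩ := eventually_atTop.1 h1
    exact ⟨max T₁ 0, le_max_right _ _, fun s hs => hT₁ s ((le_max_left _ _).trans hs)⟩
  -- One delay passes before the feedback governs the plant, then T₁ damps the state. The state must
  -- be followed up to L = T + D, because the input on the window ending at s + T is compared with K
  -- X one delay later.
  set T := T₁ + D with hT
  set L := T + D with hL
  have hT0 : 0 < T := by positivity
  obtain ⟨M', hM'⟩ := (isCompact_Icc (a := (0 : ℝ)) (b := L)).exists_bound_of_continuousOn
    (continuous_exp_smul (A + K.smulRight B)).continuousOn
  set C' := G L with hC'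
  have hC'0 : 0 < C' := hG L
  set C₂ := 1 + ‖K‖ * (M * (D * C + 1)) with hC₂
  have hC₂0 : 0 ≤ C₂ := by positivity
  set S := L * (M' * ((1 + c) * C' + C₂ * C' * ‖B‖)) with hS
  -- Total coefficient of δ: S from the state, and ‖K‖S + C₂C' from the input over a window of
  -- length D.
  set R := (1 + D * ‖K‖) * S + D * C₂ * C' with hR
  set δ := min 1 (1 / (4 * (|R| + 1))) with hδ
  have hδ0 : 0 < δ := by positivity
  have hδ1 : δ ≤ 1 := min_le_left _ _
  have hδR : δ * R ≤ 1 / 4 := by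
    calc δ * R ≤ δ * (|R| + 1) :=
          mul_le_mul_of_nonneg_left ((le_abs_self R).trans (by linarith)) hδ0.le
      _ ≤ 1 / (4 * (|R| + 1)) * (|R| + 1) :=
          mul_le_mul_of_nonneg_right (min_le_right _ _) (by positivity)
      _ = 1 / 4 := by field_simp
  refine ⟨δ, hδ0, 2 * G T, by have := hG T; positivity, Real.log 2 / T,
    div_pos (Real.log_pos one_lt_two) hT0, fun X U f h t ht => ?_⟩
  have hgrow : ∀ L s t, 0 ≤ s → s ≤ t → t ≤ s + L →
      delaySize D X U t ≤ G L * delaySize D X U s := fun L s t hs hst htL =>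
    h.delaySize_le hD.le hc hδ1 hs hst htL
  refine le_mul_exp_of_half hT0 (hG T).le ?_ (hgrow T) (delaySize_nonneg hD.le 0) ht
  intro s hs
  set N := delaySize D X U s with hN
  have hN0 : 0 ≤ N := delaySize_nonneg hD.le s
  have hX : ∀ r, s + T ≤ r → r ≤ s + L → ‖X r‖ ≤ (κ * C + δ * S) * N := by
    intro r hr hrL
    refine (h.norm_state_le hD.le hc hδ0.le hM hM' (hgrow D) (hgrow L) hs
      (by linarith) hrL).trans ?_
    have := hT₁ (r - (s + D)) (by linarith)
    gcongr
  have hU : ∀ r ∈ uIoc (s + T - D) (s + T),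
      ‖|U r|‖ ≤ (‖K‖ * (κ * C + δ * S) + δ * C₂ * C') * N := by
    intro r hr
    rw [uIoc_of_le (by linarith)] at hr
    have hsr : s ≤ r := by linarith [hr.1]
    have h1 := h.abs_input_sub_gain_le hD.le hδ0.le hM (hs.trans hsr)
      fun r' hr' => hgrow D r r' (hs.trans hsr) hr'.1 hr'.2
    have h2 := hgrow L s r hs hsr (by linarith [hr.2])
    have h3 := hX (r + D) (by linarith [hr.1]) (by linarith [hr.2])
    have h4 : |K (X (r + D))| ≤ ‖K‖ * ((κ * C + δ * S) * N) :=
      (K.le_opNorm _).trans (mul_le_mul_of_nonneg_left h3 (norm_nonneg _))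
    have h5 : δ * C₂ * delaySize D X U r ≤ δ * C₂ * (C' * N) :=
      mul_le_mul_of_nonneg_left h2 (by positivity)
    have h6 := abs_sub_abs_le_abs_sub (U r) (K (X (r + D)))
    rw [Real.norm_eq_abs, abs_abs]
    linarith
  have hI := intervalIntegral.norm_integral_le_of_norm_le_const hU
  rw [show s + T - (s + T - D) = D by ring, abs_of_pos hD] at hI
  have hI' := (le_abs_self _).trans hI
  have hκC : (1 + D * ‖K‖) * (κ * C) = 1 / 4 := by
    rw [hκ]; field_simp
  calc delaySize D X U (s + T)
      ≤ (κ * C + δ * S) * N + (‖K‖ * (κ * C + δ * S) + δ * C₂ * C') * N * D :=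
        add_le_add (hX _ le_rfl (by linarith)) hI'
    _ = ((1 + D * ‖K‖) * (κ * C) + δ * R) * N := by rw [hR]; ring
    _ ≤ 1 / 2 * N := by
        rw [hκC]
        exact mul_le_mul_of_nonneg_right (by linarith) hN0

/-! ### Predictors of nearby modes -/

section CloseModes

open Filter Topology

variable {E : Type*} [NormedAddCommGroup E] [NormedSpace ℝ E]

/-- The mode `(A, B, K)` and its transition operators over `[0, D]` are within `β` of those of the
nominal mode `(A₀, B₀, K₀)`. -/
structure IsCloseMode (D β : ℝ) (A₀ : E →L[ℝ] E) (B₀ : E) (K₀ : E →L[ℝ] ℝ)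
    (A : E →L[ℝ] E) (B : E) (K : E →L[ℝ] ℝ) : Prop where
  mat : ‖A - A₀‖ ≤ β
  input : ‖B - B₀‖ ≤ β
  gain : ‖K - K₀‖ ≤ β
  exp : ∀ s ∈ Icc 0 D, ‖NormedSpace.exp (s • A) - NormedSpace.exp (s • A₀)‖ ≤ β
  exp_input : ∀ s ∈ Icc 0 D,
    ‖NormedSpace.exp (s • A) B - NormedSpace.exp (s • A₀) B₀‖ ≤ β

theorem norm_integral_exp_le {M D : ℝ} {A : E →L[ℝ] E} {B : E}
    (hM : ∀ s ∈ Icc 0 D, ‖NormedSpace.exp (s • A)‖ ≤ M) {U : ℝ → ℝ} {a b : ℝ}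
    (hab : a ≤ b) (hbD : b - a ≤ D) (hU : IntervalIntegrable U volume a b) :
    ‖∫ θ in a..b, NormedSpace.exp ((b - θ) • A) (U θ • B)‖ ≤ M * ‖B‖ * ∫ θ in a..b, |U θ| := by
  rw [← intervalIntegral.integral_const_mul]
  refine intervalIntegral.norm_integral_le_of_norm_le hab (Eventually.of_forall fun θ hθ => ?_)
    (hU.abs.const_mul _)
  have h1 := hM (b - θ) ⟨by linarith [hθ.2], by linarith [hθ.1]⟩
  calc ‖NormedSpace.exp ((b - θ) • A) (U θ • B)‖
      ≤ ‖NormedSpace.exp ((b - θ) • A)‖ * ‖U θ • B‖ := ContinuousLinearMap.le_opNorm _ _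
    _ ≤ M * ‖U θ • B‖ := by gcongr
    _ = M * ‖B‖ * |U θ| := by rw [norm_smul, Real.norm_eq_abs]; ring

theorem norm_nominalPredictor_le {A : E →L[ℝ] E} {B : E} {D M t : ℝ} {X : ℝ → E}
    {U : ℝ → ℝ} (hD : 0 ≤ D) (hM : ∀ s ∈ Icc 0 D, ‖NormedSpace.exp (s • A)‖ ≤ M)
    (hU : IntervalIntegrable U volume (t - D) t) :
    ‖nominalPredictor A B D X U t‖ ≤ M * (1 + ‖B‖) * delaySize D X U t := by
  have hM0 : 0 ≤ M := (norm_nonneg _).trans (hM 0 ⟨le_rfl, hD⟩)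
  have h1 := norm_integral_exp_le (B := B) hM (by linarith) (by linarith) hU
  have h2 : ‖NormedSpace.exp (D • A) (X t)‖ ≤ M * ‖X t‖ :=
    (ContinuousLinearMap.le_opNorm _ _).trans
      (mul_le_mul_of_nonneg_right (hM D ⟨hD, le_rfl⟩) (norm_nonneg _))
  have hI : 0 ≤ ∫ θ in (t - D)..t, |U θ| :=
    intervalIntegral.integral_nonneg (by linarith) fun _ _ => abs_nonneg _
  have h3 : 0 ≤ M * ‖B‖ * ‖X t‖ := by positivity
  have h4 : 0 ≤ M * ∫ θ in (t - D)..t, |U θ| := by positivity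
  refine (norm_add_le _ _).trans ?_
  rw [delaySize]
  linarith

variable [CompleteSpace E]

/-- The transition operators depend jointly continuously on time and mode, and compactness of [0, D]
makes the estimate uniform in time. -/
theorem eventually_isCloseMode (D : ℝ) {β : ℝ} (hβ : 0 < β) (A₀ : E →L[ℝ] E) (B₀ : E)
    (K₀ : E →L[ℝ] ℝ) :
    ∀ᶠ m : (E →L[ℝ] E) × E × (E →L[ℝ] ℝ) in 𝓝 (A₀, B₀, K₀),
      IsCloseMode D β A₀ B₀ K₀ m.1 m.2.1 m.2.2 := by
  have hexp : Continuous (NormedSpace.exp : (E →L[ℝ] E) → (E →L[ℝ] E)) := by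
    let := NormedAlgebra.restrictScalars ℚ ℝ (E →L[ℝ] E)
    exact NormedSpace.exp_continuous
  have hsmall : ∀ {G : Type _} [SeminormedAddCommGroup G]
      (g : ((E →L[ℝ] E) × E × (E →L[ℝ] ℝ)) → G), Continuous g →
      ∀ᶠ m in 𝓝 (A₀, B₀, K₀), ‖g m - g (A₀, B₀, K₀)‖ ≤ β := by
    intro G _ g hg
    have h1 : Tendsto (fun m => ‖g m - g (A₀, B₀, K₀)‖) (𝓝 (A₀, B₀, K₀)) (𝓝 0) := by
      have : Continuous fun m => ‖g m - g (A₀, B₀, K₀)‖ := (hg.sub continuous_const).norm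
      simpa using this.tendsto (A₀, B₀, K₀)
    exact h1.eventually (ge_mem_nhds hβ)
  have hunif : ∀ {G : Type _} [SeminormedAddCommGroup G]
      (g : ℝ → ((E →L[ℝ] E) × E × (E →L[ℝ] ℝ)) → G), Continuous (Function.uncurry g) →
      ∀ᶠ m in 𝓝 (A₀, B₀, K₀), ∀ s ∈ Icc 0 D, ‖g s m - g s (A₀, B₀, K₀)‖ ≤ β := by
    intro G _ g hg
    apply isCompact_Icc.eventually_forall_of_forall_eventually
    intro s _
    have h1 : Tendsto (fun x : ((E →L[ℝ] E) × E × (E →L[ℝ] ℝ)) × ℝ =>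
        ‖g x.2 x.1 - g x.2 (A₀, B₀, K₀)‖) (𝓝 ((A₀, B₀, K₀), s)) (𝓝 0) := by
      have : Continuous fun x : ((E →L[ℝ] E) × E × (E →L[ℝ] ℝ)) × ℝ =>
          ‖g x.2 x.1 - g x.2 (A₀, B₀, K₀)‖ :=
        ((hg.comp (continuous_snd.prodMk continuous_fst)).sub
          (hg.comp (continuous_snd.prodMk continuous_const))).norm
      simpa using this.tendsto ((A₀, B₀, K₀), s)
    exact h1.eventually (ge_mem_nhds hβ)
  have hc : Continuous (Function.uncurry
      fun (s : ℝ) (m : (E →L[ℝ] E) × E × (E →L[ℝ] ℝ)) => NormedSpace.exp (s • m.1)) :=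
    hexp.comp (continuous_fst.smul (continuous_fst.comp continuous_snd))
  filter_upwards [hsmall (fun m => m.1) continuous_fst,
    hsmall (fun m => m.2.1) (continuous_fst.comp continuous_snd),
    hsmall (fun m => m.2.2) (continuous_snd.comp continuous_snd),
    hunif (fun s m => NormedSpace.exp (s • m.1)) hc,
    hunif (fun s m => NormedSpace.exp (s • m.1) m.2.1)
      (hc.clm_apply (continuous_fst.comp (continuous_snd.comp continuous_snd)))]
    with m h1 h2 h3 h4 h5
  exact ⟨h1, h2, h3, h4, h5⟩

/-- The input contributions of two modes that are close differ little. -/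
theorem norm_integral_exp_sub_le {D β : ℝ} {A₀ A : E →L[ℝ] E} {B₀ B : E} {K₀ K : E →L[ℝ] ℝ}
    (h : IsCloseMode D β A₀ B₀ K₀ A B K) {U : ℝ → ℝ} {a b : ℝ} (hab : a ≤ b) (hbD : b - a ≤ D)
    (hU : IntervalIntegrable U volume a b) :
    ‖(∫ θ in a..b, NormedSpace.exp ((b - θ) • A) (U θ • B)) -
      ∫ θ in a..b, NormedSpace.exp ((b - θ) • A₀) (U θ • B₀)‖ ≤ β * ∫ θ in a..b, |U θ| := by
  have hcont : ∀ A : E →L[ℝ] E, Continuous fun θ => NormedSpace.exp ((b - θ) • A) := fun A =>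
    (continuous_exp_smul A).comp (continuous_const.sub continuous_id)
  rw [← intervalIntegral.integral_sub
    (intervalIntegrable_clm_apply (hcont A) (intervalIntegrable_smul_const hU B))
    (intervalIntegrable_clm_apply (hcont A₀) (intervalIntegrable_smul_const hU B₀)),
    ← intervalIntegral.integral_const_mul]
  refine intervalIntegral.norm_integral_le_of_norm_le hab (Eventually.of_forall fun θ hθ => ?_)
    (hU.abs.const_mul β)
  rw [map_smul, map_smul, ← smul_sub, norm_smul, Real.norm_eq_abs, mul_comm]
  exact mul_le_mul_of_nonneg_right
    (h.exp_input _ ⟨by linarith [hθ.2], by linarith [hθ.1]⟩) (abs_nonneg _)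

/-- The nominal prediction split into two stages, the first one of length `τ`. -/
theorem nominalPredictor_eq_two_stage (A : E →L[ℝ] E) (B : E) {D τ t : ℝ} {X : ℝ → E}
    {U : ℝ → ℝ} (hτ : τ ∈ Icc 0 D) (hU : IntervalIntegrable U volume (t - D) t) :
    nominalPredictor A B D X U t =
      NormedSpace.exp ((D - τ) • A) (NormedSpace.exp (τ • A) (X t) +
        ∫ θ in (t - D)..(t + τ - D), NormedSpace.exp ((t + τ - D - θ) • A) (U θ • B)) +
      ∫ θ in (t + τ - D)..t, NormedSpace.exp ((t - θ) • A) (U θ • B) := by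
  have hcont : ∀ b : ℝ, Continuous fun θ => NormedSpace.exp ((b - θ) • A) := fun b =>
    (continuous_exp_smul A).comp (continuous_const.sub continuous_id)
  have hmid : t + τ - D ∈ uIcc (t - D) t := by
    rw [uIcc_of_le (by linarith [hτ.1, hτ.2])]
    exact ⟨by linarith [hτ.1], by linarith [hτ.2]⟩
  have hU1 : IntervalIntegrable U volume (t - D) (t + τ - D) :=
    hU.mono_set (uIcc_subset_uIcc left_mem_uIcc hmid)
  have hU2 : IntervalIntegrable U volume (t + τ - D) t :=
    hU.mono_set (uIcc_subset_uIcc hmid right_mem_uIcc)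
  rw [map_add, ← exp_add_smul_apply, sub_add_cancel,
    ← ContinuousLinearMap.intervalIntegral_comp_comm _ (intervalIntegrable_clm_apply (hcont _)
      (intervalIntegrable_smul_const hU1 B)), add_assoc, nominalPredictor]
  congr 1
  rw [← intervalIntegral.integral_add_adjacent_intervals
    (intervalIntegrable_clm_apply (hcont t) (intervalIntegrable_smul_const hU1 B))
    (intervalIntegrable_clm_apply (hcont t) (intervalIntegrable_smul_const hU2 B))]
  congr 1
  refine intervalIntegral.integral_congr fun θ _ => ?_
  rw [← exp_add_smul_apply]
  congr 3
  ring

/-- A two-stage prediction with modes close to the nominal one is close to the nominal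
prediction. -/
theorem norm_two_stage_sub_nominalPredictor_le {A₀ A A' : E →L[ℝ] E} {B₀ B B' : E}
    {K₀ K K' : E →L[ℝ] ℝ} {D β τ t M : ℝ} (hβ : β ≤ 1)
    (h : IsCloseMode D β A₀ B₀ K₀ A B K) (h' : IsCloseMode D β A₀ B₀ K₀ A' B' K')
    (hM : ∀ s ∈ Icc 0 D, ‖NormedSpace.exp (s • A₀)‖ ≤ M) {X : ℝ → E} {U : ℝ → ℝ}
    (hτ : τ ∈ Icc 0 D) (hU : IntervalIntegrable U volume (t - D) t) :
    ‖NormedSpace.exp ((D - τ) • A') (NormedSpace.exp (τ • A) (X t) +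
        ∫ θ in (t - D)..(t + τ - D), NormedSpace.exp ((t + τ - D - θ) • A) (U θ • B)) +
      (∫ θ in (t + τ - D)..t, NormedSpace.exp ((t - θ) • A') (U θ • B')) -
      nominalPredictor A₀ B₀ D X U t‖ ≤
      β * (M + 2 + M * (1 + ‖B₀‖)) * delaySize D X U t := by
  have hβ0 : 0 ≤ β := (norm_nonneg _).trans h.mat
  have hD : 0 ≤ D := hτ.1.trans hτ.2
  have hM0 : 0 ≤ M := (norm_nonneg _).trans (hM 0 ⟨le_rfl, hD⟩)
  have hmid : t + τ - D ∈ uIcc (t - D) t := by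
    rw [uIcc_of_le (by linarith)]
    exact ⟨by linarith [hτ.1], by linarith [hτ.2]⟩
  have hU1 : IntervalIntegrable U volume (t - D) (t + τ - D) :=
    hU.mono_set (uIcc_subset_uIcc left_mem_uIcc hmid)
  have hU2 : IntervalIntegrable U volume (t + τ - D) t :=
    hU.mono_set (uIcc_subset_uIcc hmid right_mem_uIcc)
  have hI1 : 0 ≤ ∫ θ in (t - D)..(t + τ - D), |U θ| :=
    intervalIntegral.integral_nonneg (by linarith [hτ.1]) fun _ _ => abs_nonneg _
  have hI2 : 0 ≤ ∫ θ in (t + τ - D)..t, |U θ| :=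
    intervalIntegral.integral_nonneg (by linarith [hτ.2]) fun _ _ => abs_nonneg _
  have hN : delaySize D X U t = ‖X t‖ + ((∫ θ in (t - D)..(t + τ - D), |U θ|) +
      ∫ θ in (t + τ - D)..t, |U θ|) := by
    rw [intervalIntegral.integral_add_adjacent_intervals hU1.abs hU2.abs, delaySize]
  have d1 := norm_integral_exp_sub_le h (by linarith [hτ.1]) (by linarith [hτ.2]) hU1
  have d2 := norm_integral_exp_sub_le h' (by linarith [hτ.2]) (by linarith [hτ.1]) hU2
  have b1 := norm_integral_exp_le (B := B₀) hM (by linarith [hτ.1]) (by linarith [hτ.2]) hU1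
  rw [nominalPredictor_eq_two_stage A₀ B₀ hτ hU]
  set J := ∫ θ in (t - D)..(t + τ - D), NormedSpace.exp ((t + τ - D - θ) • A) (U θ • B)
  set J₀ := ∫ θ in (t - D)..(t + τ - D), NormedSpace.exp ((t + τ - D - θ) • A₀) (U θ • B₀)
  set J' := ∫ θ in (t + τ - D)..t, NormedSpace.exp ((t - θ) • A') (U θ • B')
  set J₀' := ∫ θ in (t + τ - D)..t, NormedSpace.exp ((t - θ) • A₀) (U θ • B₀)
  set N := delaySize D X U t with hNdef
  set Y := NormedSpace.exp (τ • A) (X t) + J with hY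
  set Y₀ := NormedSpace.exp (τ • A₀) (X t) + J₀ with hY₀
  have hX := norm_nonneg (X t)
  have hYY : ‖Y - Y₀‖ ≤ β * N := by
    have h1 : ‖(NormedSpace.exp (τ • A) - NormedSpace.exp (τ • A₀)) (X t)‖ ≤ β * ‖X t‖ :=
      (ContinuousLinearMap.le_opNorm _ _).trans (mul_le_mul_of_nonneg_right (h.exp τ hτ) hX)
    have h2 : Y - Y₀ = (NormedSpace.exp (τ • A) - NormedSpace.exp (τ • A₀)) (X t) + (J - J₀) := by
      rw [hY, hY₀, sub_apply]; abel
    rw [h2]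
    refine (norm_add_le _ _).trans ((add_le_add h1 d1).trans ?_)
    rw [← mul_add]
    exact mul_le_mul_of_nonneg_left (by linarith) hβ0
  have hY₀n : ‖Y₀‖ ≤ M * (1 + ‖B₀‖) * N := by
    have h1 : ‖NormedSpace.exp (τ • A₀) (X t)‖ ≤ M * ‖X t‖ :=
      (ContinuousLinearMap.le_opNorm _ _).trans (mul_le_mul_of_nonneg_right (hM τ hτ) hX)
    have h2 : M * ‖X t‖ ≤ M * N := mul_le_mul_of_nonneg_left (by linarith) hM0
    have h3 : M * ‖B₀‖ * (∫ θ in (t - D)..(t + τ - D), |U θ|) ≤ M * ‖B₀‖ * N :=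
      mul_le_mul_of_nonneg_left (by linarith) (by positivity)
    refine (norm_add_le _ _).trans ?_
    linarith
  have hDτ : D - τ ∈ Icc 0 D := ⟨by linarith [hτ.2], by linarith [hτ.1]⟩
  have e1 : ‖NormedSpace.exp ((D - τ) • A')‖ ≤ M + 1 := by
    have h1 := h'.exp _ hDτ
    have h2 := hM _ hDτ
    have h3 := norm_sub_norm_le (NormedSpace.exp ((D - τ) • A')) (NormedSpace.exp ((D - τ) • A₀))
    linarith
  -- Telescoping into three errors: the first-stage prediction, the second-stage transition
  -- operator, and the second-stage input term.
  have heq : NormedSpace.exp ((D - τ) • A') Y + J' - (NormedSpace.exp ((D - τ) • A₀) Y₀ + J₀') =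
      NormedSpace.exp ((D - τ) • A') (Y - Y₀) +
      (NormedSpace.exp ((D - τ) • A') - NormedSpace.exp ((D - τ) • A₀)) Y₀ + (J' - J₀') := by
    rw [map_sub, sub_apply]; abel
  have t1 : ‖NormedSpace.exp ((D - τ) • A') (Y - Y₀)‖ ≤ (M + 1) * (β * N) :=
    (ContinuousLinearMap.le_opNorm _ _).trans
      (mul_le_mul e1 hYY (norm_nonneg _) (by positivity))
  have t2 : ‖(NormedSpace.exp ((D - τ) • A') - NormedSpace.exp ((D - τ) • A₀)) Y₀‖ ≤
      β * (M * (1 + ‖B₀‖) * N) :=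
    (ContinuousLinearMap.le_opNorm _ _).trans
      (mul_le_mul (h'.exp _ hDτ) hY₀n (norm_nonneg _) hβ0)
  have t3 : ‖J' - J₀'‖ ≤ β * N := d2.trans (mul_le_mul_of_nonneg_left (by linarith) hβ0)
  rw [heq]
  refine (norm_add₃_le).trans ?_
  linarith

end CloseModes

/-! ### Switching signals: no accumulation, measurability -/

namespace IsDwellSwitching

variable {p : ℕ} {σ : ℝ → Fin p} {tk : ℕ → ℝ} {τd τmax : ℝ}

theorem mul_le (h : IsDwellSwitching σ tk τd τmax) (n : ℕ) : n * τd ≤ tk n := by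
  induction n with
  | zero => simp [h.zero]
  | succ n ih =>
    have := h.min_dwell n
    push_cast
    linarith

theorem exists_mem_Ico (h : IsDwellSwitching σ tk τd τmax) (hτ : 0 < τd) {s : ℝ} (hs : 0 ≤ s) :
    ∃ k, s ∈ Ico (tk k) (tk (k + 1)) := by
  have hex : ∃ n, s < tk (n + 1) := by
    obtain ⟨n, hn⟩ := exists_nat_gt (s / τd)
    refine ⟨n, ?_⟩
    have h1 := h.mul_le (n + 1)
    rw [div_lt_iff₀ hτ] at hn
    push_cast at h1
    linarith
  classical
  refine ⟨Nat.find hex, ?_, Nat.find_spec hex⟩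
  rcases hk : Nat.find hex with _ | k
  · rwa [h.zero]
  · exact not_lt.1 (Nat.find_min hex (m := k) (by omega))

/-- The dwell intervals exhaust [0, ∞), so the set is a countable union of intervals. The
restriction to s ≥ 0 is needed, since σ is arbitrary at negative times. -/
theorem measurableSet_mode (h : IsDwellSwitching σ tk τd τmax) (hτ : 0 < τd) (i : Fin p) :
    MeasurableSet {s | 0 ≤ s ∧ σ s = i} := by
  have : {s | 0 ≤ s ∧ σ s = i} = ⋃ k ∈ {k | σ (tk k) = i}, Ico (tk k) (tk (k + 1)) := by
    ext s
    simp only [mem_ofPred_eq, mem_iUnion, exists_prop]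
    constructor
    · rintro ⟨hs, hi⟩
      obtain ⟨k, hk⟩ := h.exists_mem_Ico hτ hs
      exact ⟨k, (h.const k s hk).symm.trans hi, hk⟩
    · rintro ⟨k, hi, hk⟩
      refine ⟨?_, (h.const k s hk).trans hi⟩
      have := h.strictMono.monotone k.zero_le
      rw [h.zero] at this
      exact this.trans hk.1
  rw [this]
  exact MeasurableSet.biUnion (to_countable _) fun k _ => measurableSet_Ico

theorem intervalIntegrable_comp {E : Type*} [NormedAddCommGroup E]
    (h : IsDwellSwitching σ tk τd τmax) (hτ : 0 < τd) {g : Fin p → ℝ → E} {T : ℝ}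
    (hT : 0 ≤ T) (hg : ∀ i, IntervalIntegrable (g i) volume 0 T) :
    IntervalIntegrable (fun s => g (σ s) s) volume 0 T := by
  rw [intervalIntegrable_iff_integrableOn_Ioc_of_le hT]
  -- There are finitely many modes, so the switched function is a finite sum of integrable functions
  -- cut off to measurable sets.
  have h1 : IntegrableOn (fun s => ∑ i, {s | 0 ≤ s ∧ σ s = i}.indicator (g i) s) (Ioc 0 T) := by
    refine integrable_finsetSum _ fun i _ => ?_
    exact Integrable.indicator ((intervalIntegrable_iff_integrableOn_Ioc_of_le hT).1 (hg i))
      (h.measurableSet_mode hτ i)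
  refine h1.congr_fun (fun s hs => ?_) measurableSet_Ioc
  simp only
  rw [Finset.sum_eq_single (σ s)]
  · simp [indicator, hs.1.le]
  · intro i _ hi
    simp [indicator, hi.symm]
  · simp

end IsDwellSwitching

/-! ### The switched closed loop as a perturbed nominal loop -/

section ClosedLoop

variable {p q : ℕ} {A : Fin p → SysMat q} {B : Fin p → StateSpace q} {K : Fin p → Gain q}
  {D τd τmax : ℝ} {σ : ℝ → Fin p} {tk : ℕ → ℝ} {X₀ : StateSpace q} {U₀ : ℝ → ℝ}
  {X : ℝ → StateSpace q} {U : ℝ → ℝ}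

theorem horizon_mem_Icc (hD : 0 ≤ D) (t : ℝ) : horizon D τd tk t ∈ Icc 0 D :=
  ⟨le_max_left _ _, max_le hD (min_le_right _ _)⟩

namespace IsClosedLoopSolution

theorem intervalIntegrable_input (h : IsClosedLoopSolution A B K D τd σ tk X₀ U₀ X U)
    {s t : ℝ} (hs : -D ≤ s) (hst : s ≤ t) : IntervalIntegrable U volume s t := by
  have h1 := (h.memLp (max 0 t) (le_max_left _ _)).integrable one_le_two
  rw [intervalIntegrable_iff_integrableOn_Ioc_of_le hst]
  exact IntegrableOn.mono_set (t := Icc (-D) (max 0 t)) h1 fun r hr =>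
    ⟨hs.trans hr.1.le, hr.2.trans (le_max_right _ _)⟩

theorem intervalIntegrable_sq (h : IsClosedLoopSolution A B K D τd σ tk X₀ U₀ X U)
    {s t : ℝ} (hs : -D ≤ s) (hst : s ≤ t) :
    IntervalIntegrable (fun θ => U θ ^ 2) volume s t := by
  have h1 := (h.memLp (max 0 t) (le_max_left _ _)).integrable_sq
  rw [intervalIntegrable_iff_integrableOn_Ioc_of_le hst]
  exact IntegrableOn.mono_set (t := Icc (-D) (max 0 t)) h1 fun r hr =>
    ⟨hs.trans hr.1.le, hr.2.trans (le_max_right _ _)⟩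

theorem state_zero (h : IsClosedLoopSolution A B K D τd σ tk X₀ U₀ X U) : X 0 = X₀ := by
  simpa using h.plant 0 le_rfl

theorem integral_initial (h : IsClosedLoopSolution A B K D τd σ tk X₀ U₀ X U) (hD : 0 ≤ D)
    (g : ℝ → ℝ) : ∫ θ in (-D)..0, g (U θ) = ∫ θ in (-D)..0, g (U₀ θ) := by
  rw [intervalIntegral.integral_of_le (by linarith), intervalIntegral.integral_of_le (by linarith)]
  apply integral_congr_ae
  have := ae_restrict_of_ae_restrict_of_subset (Ioc_subset_Icc_self (a := -D) (b := 0)) h.initial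
  filter_upwards [this] with θ hθ
  rw [hθ]

/-- The averaged feedback is close to the nominal predictor feedback. -/
theorem abs_input_sub_nominal_le (h : IsClosedLoopSolution A B K D τd σ tk X₀ U₀ X U)
    (hD : 0 ≤ D) {A₀ : SysMat q} {B₀ : StateSpace q} {K₀ : Gain q} {β M : ℝ} (hβ : β ≤ 1)
    (hclose : ∀ i, IsCloseMode D β A₀ B₀ K₀ (A i) (B i) (K i))
    (hM : ∀ s ∈ Icc 0 D, ‖NormedSpace.exp (s • A₀)‖ ≤ M) {t : ℝ} (ht : 0 ≤ t) :
    |U t - K₀ (nominalPredictor A₀ B₀ D X U t)| ≤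
      β * ((‖K₀‖ + 1) * (M + 2 + M * (1 + ‖B₀‖)) + M * (1 + ‖B₀‖)) * delaySize D X U t := by
  set P := nominalPredictor A₀ B₀ D X U t with hP
  set N := delaySize D X U t with hN
  have hU := h.intervalIntegrable_input (s := t - D) (t := t) (by linarith) (by linarith)
  set W := β * ((‖K₀‖ + 1) * (M + 2 + M * (1 + ‖B₀‖)) + M * (1 + ‖B₀‖)) * N with hW
  have hi : ∀ i, |K i (modePredictor A B D τd σ tk X U i t) - K₀ P| ≤ W := by
    intro i
    have hβ0 : 0 ≤ β := (norm_nonneg _).trans (hclose i).mat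
    have h1 := norm_two_stage_sub_nominalPredictor_le hβ (hclose (σ (lastSwitch tk t))) (hclose i)
      hM (X := X) (horizon_mem_Icc (τd := τd) (tk := tk) hD t) hU
    change ‖modePredictor A B D τd σ tk X U i t - P‖ ≤ _ at h1
    have h2 := norm_nominalPredictor_le (B := B₀) (X := X) hD hM hU
    have h3 : ‖K i‖ ≤ ‖K₀‖ + 1 := by
      have := norm_sub_norm_le (K i) K₀
      linarith [(hclose i).gain]
    have h4 : K i (modePredictor A B D τd σ tk X U i t) - K₀ P =
        K i (modePredictor A B D τd σ tk X U i t - P) + (K i - K₀) P := by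
      rw [map_sub, sub_apply]; ring
    have h5 : |K i (modePredictor A B D τd σ tk X U i t - P)| ≤
        (‖K₀‖ + 1) * (β * (M + 2 + M * (1 + ‖B₀‖)) * N) :=
      ((K i).le_opNorm _).trans (mul_le_mul h3 h1 (norm_nonneg _) (by positivity))
    have h6 : |(K i - K₀) P| ≤ β * (M * (1 + ‖B₀‖) * N) :=
      ((K i - K₀).le_opNorm _).trans (mul_le_mul (hclose i).gain h2 (norm_nonneg _) hβ0)
    rw [h4, hW]
    refine (abs_add_le _ _).trans ?_
    linarith
  -- The value σ 0 exhibits a mode, so the average is over a nonempty family and the nominal term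
  -- can be moved inside it.
  have hp : (0 : ℝ) < p := by exact_mod_cast Fin.pos (σ 0)
  have hU' : U t - K₀ P =
      (1 / (p : ℝ)) * ∑ i, (K i (modePredictor A B D τd σ tk X U i t) - K₀ P) := by
    rw [h.control t ht, averagedFeedback, Finset.sum_sub_distrib, Finset.sum_const,
      Finset.card_univ, Fintype.card_fin, nsmul_eq_mul]
    field_simp
  rw [hU', abs_mul, abs_of_pos (by positivity : (0 : ℝ) < 1 / p)]
  calc 1 / (p : ℝ) * |∑ i, (K i (modePredictor A B D τd σ tk X U i t) - K₀ P)|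
      ≤ 1 / (p : ℝ) * ∑ _i : Fin p, W := by
        gcongr
        exact (Finset.abs_sum_le_sum_abs _ _).trans (Finset.sum_le_sum fun i _ => hi i)
    _ = W := by
        rw [Finset.sum_const, Finset.card_univ, Fintype.card_fin, nsmul_eq_mul]
        field_simp

/-- A closed-loop solution whose modes are all close to a nominal mode is a small perturbation
of the nominal predictor feedback loop. -/
theorem isPerturbedLoop (h : IsClosedLoopSolution A B K D τd σ tk X₀ U₀ X U)
    (hσ : IsDwellSwitching σ tk τd τmax) (hτd : 0 < τd) (hD : 0 ≤ D)
    {A₀ : SysMat q} {B₀ : StateSpace q} {K₀ : Gain q} {β δ M : ℝ} (hβ : β ≤ 1) (hβδ : β ≤ δ)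
    (hclose : ∀ i, IsCloseMode D β A₀ B₀ K₀ (A i) (B i) (K i))
    (hM : ∀ s ∈ Icc 0 D, ‖NormedSpace.exp (s • A₀)‖ ≤ M)
    (hβM : β * ((‖K₀‖ + 1) * (M + 2 + M * (1 + ‖B₀‖)) + M * (1 + ‖B₀‖)) ≤ min 1 δ) :
    IsPerturbedLoop A₀ B₀ K₀ D (1 + ‖K₀‖ * (M * (1 + ‖B₀‖))) δ X U
      (fun s => (A (σ s) - A₀) (X s) + U (s - D) • (B (σ s) - B₀)) where
  continuousOn := h.continuousOn
  integrable_input T hT := h.intervalIntegrable_input le_rfl (by linarith)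
  integrable_forcing T hT := by
    refine hσ.intervalIntegrable_comp hτd
      (g := fun i s => (A i - A₀) (X s) + U (s - D) • (B i - B₀)) hT fun i => ?_
    refine (intervalIntegrable_clm_comp _ ?_).add (intervalIntegrable_smul_const ?_ _)
    · refine (h.continuousOn.mono ?_).intervalIntegrable
      rw [uIcc_of_le hT]
      exact Icc_subset_Ici_self
    · simpa using (h.intervalIntegrable_input (s := 0 - D) (t := T - D)
        (by linarith) (by linarith)).comp_sub_right D
  plant t ht := by
    rw [h.plant t ht, h.state_zero]
    congr 2
    ext1 s
    rw [sub_apply, smul_sub]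
    abel
  forcing_le r hr := by
    refine (norm_add_le _ _).trans ?_
    rw [mul_add, norm_smul, Real.norm_eq_abs, mul_comm |U (r - D)|]
    refine add_le_add ((ContinuousLinearMap.le_opNorm _ _).trans ?_) ?_
    · exact mul_le_mul_of_nonneg_right ((hclose _).mat.trans hβδ) (norm_nonneg _)
    · exact mul_le_mul_of_nonneg_right ((hclose _).input.trans hβδ) (abs_nonneg _)
  -- The nominal feedback is at most ‖K₀‖M(1 + ‖B₀‖) times the size; the extra 1 in the constant
  -- absorbs the deviation from it.
  input_le t ht := by
    have hN : 0 ≤ delaySize D X U t := delaySize_nonneg hD t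
    have h1 := (h.abs_input_sub_nominal_le hD hβ hclose hM ht).trans
      (mul_le_mul_of_nonneg_right (hβM.trans (min_le_left _ _)) hN)
    have h2 := norm_nominalPredictor_le (B := B₀) (X := X) hD hM
      (h.intervalIntegrable_input (s := t - D) (t := t) (by linarith) (by linarith))
    have h3 : |K₀ (nominalPredictor A₀ B₀ D X U t)| ≤
        ‖K₀‖ * (M * (1 + ‖B₀‖) * delaySize D X U t) :=
      (K₀.le_opNorm _).trans (mul_le_mul_of_nonneg_left h2 (norm_nonneg _))
    have h4 := abs_sub_abs_le_abs_sub (U t) (K₀ (nominalPredictor A₀ B₀ D X U t))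
    linarith
  control t ht := (h.abs_input_sub_nominal_le hD hβ hclose hM ht).trans
    (mul_le_mul_of_nonneg_right (hβM.trans (min_le_right _ _)) (delaySize_nonneg hD t))

end IsClosedLoopSolution

/-! ### From L¹ to L² size of the input -/

/-- The Cauchy-Schwarz bound of an integral of `|U|` by the `L²` norm of `U`. -/
theorem integral_abs_le_sqrt {U : ℝ → ℝ} {a b : ℝ} (hab : a ≤ b)
    (h1 : IntervalIntegrable U volume a b)
    (h2 : IntervalIntegrable (fun θ => U θ ^ 2) volume a b) :
    ∫ θ in a..b, |U θ| ≤ √(b - a) * √(∫ θ in a..b, U θ ^ 2) := by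
  rcases hab.eq_or_lt with rfl | hab'
  · simp
  rw [← Real.sqrt_mul (by linarith)]
  apply Real.le_sqrt_of_sq_le
  set I := ∫ θ in a..b, |U θ| with hI
  set J := ∫ θ in a..b, U θ ^ 2 with hJ
  -- The integral of the nonnegative square ((b-a)|U| - I)² equals (b-a)((b-a)J - I²).
  have h3 : 0 ≤ ∫ θ in a..b, ((b - a) ^ 2 * U θ ^ 2 - (2 * (b - a) * I) * |U θ| + I ^ 2) := by
    refine intervalIntegral.integral_nonneg hab fun θ _ => ?_
    have := sq_nonneg ((b - a) * |U θ| - I)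
    rw [sub_sq, mul_pow, sq_abs] at this
    linarith
  rw [intervalIntegral.integral_add ((h2.const_mul _).sub (h1.abs.const_mul _))
    intervalIntegrable_const, intervalIntegral.integral_sub (h2.const_mul _) (h1.abs.const_mul _),
    intervalIntegral.integral_const_mul, intervalIntegral.integral_const_mul,
    intervalIntegral.integral_const, smul_eq_mul] at h3
  have h4 : 0 ≤ (b - a) * ((b - a) * J - I ^ 2) := by linarith
  have := nonneg_of_mul_nonneg_right h4 (by linarith)
  linarith

/-- Exponential decay with the input measured in `L¹` implies exponential decay with the input
measured in `L²`, the input being bounded by the state size. -/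
theorem IsClosedLoopSolution.l2_decay (h : IsClosedLoopSolution A B K D τd σ tk X₀ U₀ X U)
    (hD : 0 < D) {c ρ ξ : ℝ} (hc : 0 ≤ c) (hρ : 0 ≤ ρ) (hξ : 0 ≤ ξ)
    (hU : ∀ t, 0 ≤ t → |U t| ≤ c * delaySize D X U t)
    (hN : ∀ t, 0 ≤ t → delaySize D X U t ≤ ρ * delaySize D X U 0 * Real.exp (-ξ * t))
    {t : ℝ} (ht : 0 ≤ t) :
    ‖X t‖ + √(∫ θ in (t - D)..t, U θ ^ 2) ≤
      (ρ * (1 + √D) + Real.exp (ξ * D) + √D * (c * ρ * (1 + √D) * Real.exp (ξ * D))) *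
        (‖X₀‖ + √(∫ θ in (-D)..0, U₀ θ ^ 2)) * Real.exp (-ξ * t) := by
  have hUi := h.intervalIntegrable_input (s := -D) (t := 0) le_rfl (by linarith)
  have hU2 := h.intervalIntegrable_sq (s := -D) (t := 0) le_rfl (by linarith)
  have hinit : ∫ θ in (-D)..0, U₀ θ ^ 2 = ∫ θ in (-D)..0, U θ ^ 2 :=
    (h.integral_initial hD.le fun x => x ^ 2).symm
  rw [hinit]
  set J := ∫ θ in (-D)..0, U θ ^ 2 with hJ
  have hJ0 : 0 ≤ J := intervalIntegral.integral_nonneg (by linarith) fun _ _ => sq_nonneg _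
  set S := ‖X₀‖ + √J with hS
  have hN0 : delaySize D X U 0 ≤ (1 + √D) * S := by
    have h1 := integral_abs_le_sqrt (by linarith) hUi hU2
    rw [show (0 : ℝ) - -D = D by ring] at h1
    have h2 : 0 ≤ √D * ‖X₀‖ := by positivity
    have h3 : 0 ≤ √J := Real.sqrt_nonneg _
    rw [delaySize, h.state_zero, zero_sub, hS]
    linarith
  have hS0 : 0 ≤ S := by positivity
  have hNt : ∀ r, 0 ≤ r → delaySize D X U r ≤ ρ * (1 + √D) * S * Real.exp (-ξ * r) :=
    fun r hr => (hN r hr).trans (by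
      rw [mul_assoc ρ (1 + √D)]
      gcongr)
  set Z := c * ρ * (1 + √D) * Real.exp (ξ * D) * S * Real.exp (-ξ * t) with hZ
  have hZ0 : 0 ≤ Z := by positivity
  have hUZ : ∀ r, 0 ≤ r → t - D ≤ r → U r ^ 2 ≤ Z ^ 2 := by
    intro r hr htr
    rw [← sq_abs]
    refine pow_le_pow_left₀ (abs_nonneg _) ?_ 2
    calc |U r| ≤ c * (ρ * (1 + √D) * S * Real.exp (-ξ * r)) :=
          (hU r hr).trans (mul_le_mul_of_nonneg_left (hNt r hr) hc)
      _ ≤ c * (ρ * (1 + √D) * S * (Real.exp (ξ * D) * Real.exp (-ξ * t))) := by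
          rw [← Real.exp_add]
          gcongr
          nlinarith
      _ = Z := by rw [hZ]; ring
  -- The window is split at time 0, if it reaches that far back: the feedback bound holds only after
  -- 0, and before it the input is initial data.
  set w := max (t - D) 0 with hw
  have hw1 : t - D ≤ w := le_max_left _ _
  have hw2 : 0 ≤ w := le_max_right _ _
  have hw3 : w ≤ t := max_le (by linarith) ht
  have hI1 : ∫ θ in (t - D)..w, U θ ^ 2 ≤ (Real.exp (ξ * D) * Real.exp (-ξ * t)) ^ 2 * J := by
    rcases le_total D t with hDt | hDt
    · rw [hw, max_eq_left (by linarith), intervalIntegral.integral_same]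
      positivity
    · rw [hw, max_eq_right (by linarith)]
      have h1 : ∫ θ in (t - D)..0, U θ ^ 2 ≤ J :=
        intervalIntegral.integral_mono_interval (by linarith) (by linarith) le_rfl
          (Filter.Eventually.of_forall fun _ => sq_nonneg _) hU2
      -- Initial data remain in the window only while t ≤ D, when exp(ξ(D - t)) ≥ 1; this is the
      -- origin of the factor exp(ξD).
      refine h1.trans (le_mul_of_one_le_left hJ0 (one_le_pow₀ ?_))
      rw [← Real.exp_add, Real.one_le_exp_iff]
      nlinarith
  have hI2 : ∫ θ in w..t, U θ ^ 2 ≤ D * Z ^ 2 := by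
    have h1 := intervalIntegral.integral_mono_on hw3
      (h.intervalIntegrable_sq (by linarith) hw3) (intervalIntegrable_const (c := Z ^ 2))
      fun r hr => hUZ r (hw2.trans hr.1) (hw1.trans hr.1)
    rw [intervalIntegral.integral_const, smul_eq_mul] at h1
    exact h1.trans (mul_le_mul_of_nonneg_right (by linarith) (sq_nonneg _))
  have hsplit := intervalIntegral.integral_add_adjacent_intervals
    (h.intervalIntegrable_sq (s := t - D) (by linarith) hw1)
    (h.intervalIntegrable_sq (by linarith) hw3)
  have hsqrt : √(∫ θ in (t - D)..t, U θ ^ 2) ≤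
      Real.exp (ξ * D) * Real.exp (-ξ * t) * √J + √D * Z := by
    rw [← hsplit]
    refine Real.sqrt_le_iff.2 ⟨by positivity, (add_le_add hI1 hI2).trans ?_⟩
    have h1 : 0 ≤ 2 * (Real.exp (ξ * D) * Real.exp (-ξ * t) * √J) * (√D * Z) := by positivity
    rw [add_sq, mul_pow _ (√J), mul_pow (√D), Real.sq_sqrt hJ0, Real.sq_sqrt hD.le]
    linarith
  have hXt := (norm_le_delaySize hD.le t).trans (hNt t ht)
  have hJS : √J ≤ S := le_add_of_nonneg_left (norm_nonneg _)
  calc ‖X t‖ + √(∫ θ in (t - D)..t, U θ ^ 2)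
      ≤ ρ * (1 + √D) * S * Real.exp (-ξ * t) +
        (Real.exp (ξ * D) * Real.exp (-ξ * t) * S + √D * Z) := by
        refine add_le_add hXt (hsqrt.trans ?_)
        gcongr
    _ = _ := by rw [hZ]; ring

/-! ### Stability near one mode, and uniformity over a compact set -/

open Filter Topology in
/-- Around every mode with a Hurwitz closed loop, all families of modes in a neighbourhood are
uniformly exponentially stable under switching with a positive dwell time. -/
theorem eventually_uniform_stability {D : ℝ} (hD : 0 < D) (A₀ : SysMat q) (B₀ : StateSpace q)
    (K₀ : Gain q) (hH : IsHurwitz (closedLoopMat A₀ B₀ K₀)) :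
    ∃ V ∈ 𝓝 (A₀, B₀, K₀), ∃ ρ > (0 : ℝ), ∃ ξ > (0 : ℝ),
      ∀ (p : ℕ) (A : Fin p → SysMat q) (B : Fin p → StateSpace q) (K : Fin p → Gain q),
        (∀ i, (A i, B i, K i) ∈ V) →
        ∀ (τd τmax : ℝ), 0 < τd →
        ∀ (σ : ℝ → Fin p) (tk : ℕ → ℝ), IsDwellSwitching σ tk τd τmax →
        ∀ (X₀ : StateSpace q) (U₀ : ℝ → ℝ) (X : ℝ → StateSpace q) (U : ℝ → ℝ),
          IsClosedLoopSolution A B K D τd σ tk X₀ U₀ X U → ∀ t, 0 ≤ t →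
            ‖X t‖ + √(∫ θ in (t - D)..t, U θ ^ 2) ≤
              ρ * (‖X₀‖ + √(∫ θ in (-D)..0, U₀ θ ^ 2)) * Real.exp (-ξ * t) := by
  obtain ⟨M, hM⟩ := (isCompact_Icc (a := (0 : ℝ)) (b := D)).exists_bound_of_continuousOn
    (continuous_exp_smul A₀).continuousOn
  have hM0 : 0 ≤ M := (norm_nonneg _).trans (hM 0 ⟨le_rfl, hD.le⟩)
  set c := 1 + ‖K₀‖ * (M * (1 + ‖B₀‖)) with hc
  have hc0 : 0 ≤ c := by positivity
  obtain ⟨δ, hδ, ρ, hρ, ξ, hξ, hdecay⟩ :=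
    exists_perturbedLoop_decay A₀ B₀ K₀ hD hc0 hH.tendsto_exp_smul
  set Q := (‖K₀‖ + 1) * (M + 2 + M * (1 + ‖B₀‖)) + M * (1 + ‖B₀‖) with hQ
  have hQ1 : 1 ≤ Q := by
    have h1 : 0 ≤ M * (1 + ‖B₀‖) := by positivity
    have h2 : 1 * (2 : ℝ) ≤ (‖K₀‖ + 1) * (M + 2 + M * (1 + ‖B₀‖)) :=
      mul_le_mul (by linarith [norm_nonneg K₀]) (by linarith) (by norm_num) (by positivity)
    linarith
  -- Q is the factor by which mode differences are amplified in the feedback; as Q ≥ 1, this β meets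
  -- both the bound on the modes and the bound on the feedback.
  set β := min 1 δ / Q with hβ
  have hmin : 0 < min 1 δ := lt_min one_pos hδ
  have hβ0 : 0 < β := by positivity
  have hβm : β ≤ min 1 δ := div_le_self hmin.le hQ1
  have hβQ : β * Q ≤ min 1 δ := (div_mul_cancel₀ _ (by positivity)).le
  refine ⟨_, eventually_isCloseMode D hβ0 A₀ B₀ K₀,
    ρ * (1 + √D) + Real.exp (ξ * D) + √D * (c * ρ * (1 + √D) * Real.exp (ξ * D)),
    by positivity, ξ, hξ, ?_⟩
  intro p A B K hV τd τmax hτd σ tk hσ X₀ U₀ X U h t ht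
  have hpert := h.isPerturbedLoop hσ hτd hD.le (hβm.trans (min_le_left _ _))
    (hβm.trans (min_le_right _ _)) hV hM hβQ
  exact h.l2_decay hD hc0 hρ.le hξ.le hpert.input_le (hdecay X U _ hpert) ht

end ClosedLoop

/-- The sup metric on triples is the one in which the spread is measured, so a Lebesgue number for
that metric serves directly as a bound on the spread. -/
theorem dist_le_modeSpread {p q : ℕ} (A : Fin p → SysMat q) (B : Fin p → StateSpace q)
    (K : Fin p → Gain q) (i j : Fin p) :
    dist (A i, B i, K i) (A j, B j, K j) ≤ modeSpread A B K := by
  rw [Prod.dist_eq, Prod.dist_eq, dist_eq_norm, dist_eq_norm, dist_eq_norm]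
  exact le_ciSup (f := fun ij : Fin p × Fin p =>
    max ‖A ij.1 - A ij.2‖ (max ‖B ij.1 - B ij.2‖ ‖K ij.1 - K ij.2‖))
    (finite_range _).bddAbove (i, j)

theorem theorem2 (q : ℕ) (D : ℝ) (hD : 0 < D)
    (𝒦 : Set (SysMat q × StateSpace q × Gain q)) (h𝒦 : IsCompact 𝒦)
    (hHurwitz : ∀ m ∈ 𝒦, IsHurwitz (closedLoopMat m.1 m.2.1 m.2.2)) :
    ∃ τStar > (0 : ℝ), ∃ εStar > (0 : ℝ),
      ∀ (p : ℕ) (A : Fin p → SysMat q) (B : Fin p → StateSpace q) (K : Fin p → Gain q),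
        (∀ i, (A i, B i, K i) ∈ 𝒦) →
        modeSpread A B K < εStar →
        ∀ τd > τStar, ∀ τmax : ℝ,
          ∃ ρ > (0 : ℝ), ∃ ξ > (0 : ℝ),
            ∀ (σ : ℝ → Fin p) (tk : ℕ → ℝ), IsDwellSwitching σ tk τd τmax →
            ∀ (X₀ : StateSpace q) (U₀ : ℝ → ℝ),
              MemLp U₀ 2 (volume.restrict (Icc (-D) 0)) →
            ∀ (X : ℝ → StateSpace q) (U : ℝ → ℝ),
              IsClosedLoopSolution A B K D τd σ tk X₀ U₀ X U →
            ∀ t : ℝ, 0 ≤ t →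
              ‖X t‖ + √(∫ θ in (t - D)..t, U θ ^ 2) ≤
                ρ * (‖X₀‖ + √(∫ θ in (-D)..0, U₀ θ ^ 2)) * Real.exp (-ξ * t) := by
  have hloc : ∀ m : 𝒦, _ := fun m =>
    eventually_uniform_stability hD m.1.1 m.1.2.1 m.1.2.2 (hHurwitz m.1 m.2)
  choose V hV ρ hρ ξ hξ hstable using hloc
  obtain ⟨ε, hε, hball⟩ := lebesgue_number_lemma_of_metric (c := fun m : 𝒦 => interior (V m)) h𝒦
    (fun m => isOpen_interior) fun m hm =>
      mem_iUnion.2 ⟨⟨m, hm⟩, mem_interior_iff_mem_nhds.2 (hV ⟨m, hm⟩)⟩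
  -- Any positive dwell threshold would do, since stability near a mode holds for every positive
  -- dwell time; the threshold for the spread is the Lebesgue number.
  refine ⟨1, one_pos, ε, hε, fun p A B K hmem hspread τd hτd τmax => ?_⟩
  -- With no modes there is no switching signal, so the claim is vacuous. Otherwise mode 0 serves as
  -- centre of the ball containing all modes.
  rcases p.eq_zero_or_pos with rfl | hp
  · exact ⟨1, one_pos, 1, one_pos, fun σ => (σ 0).elim0⟩
  obtain ⟨m, hm⟩ := hball _ (hmem ⟨0, hp⟩)
  refine ⟨ρ m, hρ m, ξ m, hξ m, fun σ tk hσ X₀ U₀ _ X U h => ?_⟩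
  refine hstable m p A B K (fun i => interior_subset (hm ?_)) τd τmax (one_pos.trans hτd)
    σ tk hσ X₀ U₀ X U h
  exact Metric.mem_ball.2 ((dist_le_modeSpread A B K i ⟨0, hp⟩).trans_lt hspread)
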